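/- Consider the under-actuated ship, the control system with states $(x,y,\theta,z)\in\mathbb R^4$ and controls $(u_1,u_2)\in\mathbb R^2$ $$\dot x=u_1\cos\theta-z\sin\theta,\quad \dot y=u_1\sin\theta+z\cos\theta,\quad \dot\theta=u_2,\quad \dot z=-u_1u_2-z .$$ For $k\ge 0$ let $\mathrm{pr}^k\mathcal E$ be the system obtained by prolonging $u_2$ $k$ times; thus $\mathrm{pr}^4\mathcal E$ has states $(x,y,\theta,z,u_2,v_1,v_2,v_3)$, controls $(u_1,v_4)$ and the additional equations $\dot u_2=v_1,\ \dot v_1=v_2,\ \dot v_2=v_3,\ \dot v_3=v_4$. A control system $\dot{\mathbf x}=\mathbf f(t,\mathbf x,\mathbf u)$ is identified with the distribution spanned by $\mathbf T=\partial_t+\mathbf f\,\partial_{\mathbf x}$ and $\partial_{\mathbf u}$. A static feedback transformation between two control systems is a diffeomorphism between open sets, of the form $(t,\mathbf x,\mathbf u)\mapsto(t,\alpha(t,\mathbf x),\beta(t,\mathbf x,\mathbf u))$, that maps one distribution to the other. $\mathcal C\langle\rho_1,\dots,\rho_k\rangle$ denotes the Brunovsky normal form with $\rho_\ell$ chains of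 integrators of length $\ell$, that is, $\rho_\ell$ dependent variables $z_0$ of order $\ell$ with $\dot z_i=z_{i+1}$ for $0\le i<\ell$, where $z_\ell$ is a control. A system is static feedback linearizable near a point if on a neighbourhood of it some static feedback transformation identifies it with some $\mathcal C\langle\rho_1,\dots,\rho_k\rangle$. Put $$a=\big(2yu_2^2-x(v_1+u_2)\big)\sin\theta+\big(2xu_2^2+y(v_1+u_2)\big)\cos\theta+2zu_2,\qquad \ell=u_2^2+4u_2^4+2u_2v_2-3v_1^2 .$$ 1. The set $\{\ell\ne0\}$ is open and dense in the space of $(t,x,y,\theta,z,u_2,v_1,v_2,v_3,u_1,v_4)$, and on it the map $$\big(t;\ a,\mathbf Ta,\mathbf T^2a,\mathbf T^3a;\ \theta,\mathbf T\theta,\dots,\mathbf T^5\theta\big),$$ where $\mathbf T$ is the field of $\mathrm{pr}^4\mathcal E$, is a static feedback transformation (a diffeomorphism onto an open set) that identifies $\mathrm{pr}^4\mathcal E$ with $\mathcal C\langle0,0,1,0,1\rangle$. 2. For $k=0,1,2,3$, $\mathrm{pr}^k\mathcal E$ is not static feedback linearizable near any point; so four prolongations in the direction $\partial_{u_2}$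 are required. 3. The ship is flat, with flat output $(a,\theta)$, where $v_1=\dot u_2$ and $v_2=\ddot u_2$: the set of $(t,x,y,\theta,z,u,\dot u,\ddot u)$ with $\ell\neq0$ is open and dense; along smooth trajectories in this set the states and controls are smooth functions $F$ of $t$ and finitely many derivatives of $(a,\theta)$, $F$ being defined on an open set $W$; and $a,\theta$ are differentially independent: every smooth curve $t\mapsto(a(t),\theta(t))$ on an open interval whose jets lie in $W$ arises so from a trajectory in this set, which is the one given by $F$. -/

import Mathlib

open scoped ContDiff Topology

noncomputable section

namespace ShipControl

/-- A control system `ẋ = f (t, x, u)` with states indexed by `ι` and controls indexed by `μ`. -/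
abbrev ControlSystem (ι μ : Type) : Type :=
  ℝ → (ι → ℝ) → (μ → ℝ) → (ι → ℝ)

/-- The manifold of time, states and controls, with points `(t, x, u)`. -/
abbrev Phase (ι μ : Type) : Type := ℝ × (ι → ℝ) × (μ → ℝ)

/-- The vector field `T = ∂_t + f (t, x, u) ∂_x`. -/
def totalField {ι μ : Type} (S : ControlSystem ι μ) (p : Phase ι μ) : Phase ι μ :=
  (1, S p.1 p.2.1 p.2.2, 0)

/-- The distribution `{∂_t + f ∂_x, ∂_u}` of a control system. -/
def distribution {ι μ : Type} (S : ControlSystem ι μ) (p : Phase ι μ) :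
    Submodule ℝ (Phase ι μ) :=
  Submodule.span ℝ ({totalField S p} ∪ Set.range fun w : μ → ℝ => ((0, 0, w) : Phase ι μ))

/-- The derivative of a function along `T = ∂_t + f ∂_x`. -/
def totalDeriv {ι μ : Type} [Fintype ι] [Fintype μ] (S : ControlSystem ι μ)
    (h : Phase ι μ → ℝ) (p : Phase ι μ) : ℝ :=
  fderiv ℝ h p (totalField S p)

/-- One prolongation in the direction of the control `u_j`: the control `u_j` becomes the new
(last) state, and its derivative becomes the new `j`-th control. -/
def prolong {n : ℕ} {μ : Type} [DecidableEq μ] (S : ControlSystem (Fin n) μ) (j : μ) :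
    ControlSystem (Fin (n + 1)) μ :=
  fun t X v => Fin.snoc (α := fun _ => ℝ)
    (S t (fun i => X i.castSucc) (Function.update v j (X (Fin.last n)))) (v j)

/-- The `k`-fold prolongation in the direction of the control `u_j`. -/
def prolongIter {n : ℕ} {μ : Type} [DecidableEq μ] (S : ControlSystem (Fin n) μ) (j : μ) :
    (k : ℕ) → ControlSystem (Fin (n + k)) μ
  | 0 => S
  | k + 1 => prolong (prolongIter S j k) j

/-- The Brunovsky normal form with one chain of integrators
`ż^j_0 = z^j_1, …, ż^j_{κ_j - 1} = v_j` of length `κ_j` for every control `v_j`. -/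
def brunovsky {μ : Type} (κ : μ → ℕ) : ControlSystem (Σ j : μ, Fin (κ j)) μ :=
  fun _ z v q => if h : (q.2 : ℕ) + 1 < κ q.1 then z ⟨q.1, ⟨(q.2 : ℕ) + 1, h⟩⟩ else v q.1

/-- The index set of the dependent variables of `C⟨ρ_1, …, ρ_k⟩`: there are `ρ_ℓ` variables of
order `ℓ`. As `Fin k` starts at zero, `ρ ℓ` is the number of variables of order `ℓ + 1`. -/
abbrev SigIndex {k : ℕ} (ρ : Fin k → ℕ) : Type := Σ ℓ : Fin k, Fin (ρ ℓ)

/-- The order of a dependent variable of `C⟨ρ_1, …, ρ_k⟩`. -/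
abbrev sigOrder {k : ℕ} (ρ : Fin k → ℕ) (j : SigIndex ρ) : ℕ := (j.1 : ℕ) + 1

/-- The index set of the states of `C⟨ρ_1, …, ρ_k⟩`. -/
abbrev SigState {k : ℕ} (ρ : Fin k → ℕ) : Type := Σ j : SigIndex ρ, Fin (sigOrder ρ j)

/-- The Brunovsky normal form `C⟨ρ_1, …, ρ_k⟩` as a control system. -/
def contactSystem {k : ℕ} (ρ : Fin k → ℕ) : ControlSystem (SigState ρ) (SigIndex ρ) :=
  brunovsky (sigOrder ρ)

/-- `Φ` is an (extended) static feedback transformation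
`(t, x, u) ↦ (t, α (t, x), β (t, x, u))` that identifies the distributions of `S` and `S'`. -/
structure IsStaticFeedback {ι μ ι' μ' : Type} [Fintype ι] [Fintype μ] [Fintype ι'] [Fintype μ']
    (S : ControlSystem ι μ) (S' : ControlSystem ι' μ')
    (Φ : OpenPartialHomeomorph (Phase ι μ) (Phase ι' μ')) : Prop where
  smooth : ContDiffOn ℝ ∞ Φ Φ.source
  smooth_symm : ContDiffOn ℝ ∞ Φ.symm Φ.target
  form : ∃ (α : ℝ → (ι → ℝ) → (ι' → ℝ)) (β : ℝ → (ι → ℝ) → (μ → ℝ) → (μ' → ℝ)),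
    ∀ t x u, (t, x, u) ∈ Φ.source → Φ (t, x, u) = (t, α t x, β t x u)
  map_distribution : ∀ p ∈ Φ.source,
    (distribution S p).map (fderiv ℝ Φ p : Phase ι μ →ₗ[ℝ] Phase ι' μ') = distribution S' (Φ p)

/-- `S` is static feedback linearizable near `p`: on a neighbourhood of `p` some static feedback
transformation identifies it with a Brunovsky normal form. -/
def StaticFeedbackLinearizableAt {ι μ : Type} [Fintype ι] [Fintype μ] (S : ControlSystem ι μ)
    (p : Phase ι μ) : Prop :=
  ∃ (k : ℕ) (ρ : Fin k → ℕ)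
    (Φ : OpenPartialHomeomorph (Phase ι μ) (Phase (SigState ρ) (SigIndex ρ))),
    p ∈ Φ.source ∧ IsStaticFeedback S (contactSystem ρ) Φ

/-- The map to the space of `C⟨ρ_1, …, ρ_k⟩` obtained from functions `h_j`, one for every dependent
variable, by differentiating along `T`: `z^j_i = T^i h_j` for `i` up to the order of `j`. -/
def contactMap {ι μ : Type} [Fintype ι] [Fintype μ] (S : ControlSystem ι μ) {k : ℕ}
    (ρ : Fin k → ℕ) (h : SigIndex ρ → Phase ι μ → ℝ) (p : Phase ι μ) :
    Phase (SigState ρ) (SigIndex ρ) :=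
  (p.1, fun q => (totalDeriv S)^[(q.2 : ℕ)] (h q.1) p,
    fun j => (totalDeriv S)^[sigOrder ρ j] (h j) p)

/-- A smooth trajectory of a control system on a set of times (used for open intervals). -/
structure IsTrajectory {ι μ : Type} [Fintype ι] [Fintype μ] (S : ControlSystem ι μ) (I : Set ℝ)
    (x : ℝ → ι → ℝ) (u : ℝ → μ → ℝ) : Prop where
  smooth_state : ContDiffOn ℝ ∞ x I
  smooth_control : ContDiffOn ℝ ∞ u I
  ode : ∀ t ∈ I, HasDerivAt x (S t (x t) (u t)) t

/-- The `r`-jet `(y, ẏ, …, y^(r))` of a curve at time `t`. -/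
def jet {μ : Type} [Fintype μ] (r : ℕ) (y : ℝ → μ → ℝ) (t : ℝ) : Fin (r + 1) → μ → ℝ :=
  fun i => iteratedDeriv (i : ℕ) y t

/-- The space of `(t, x, u, u̇, …, u^(r))`. -/
abbrev ControlJet (ι μ : Type) (r : ℕ) : Type := ℝ × (ι → ℝ) × (Fin (r + 1) → μ → ℝ)

/-- `y = h (t, x, u, …, u^(r))` is a flat output on the open set `Ω`: it has as many components as
there are controls; along trajectories whose jets lie in `Ω` the state and the control are smooth
functions `F` of `t` and finitely many derivatives of `y`; and the components of `y` satisfy no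
differential relation, that is, every smooth curve `y` with jets in the (open) domain of `F` comes
in this way from a trajectory with jets in `Ω`, namely from `(x, u) = F (t, y, ẏ, …, y^(s))`. -/
def IsFlatOutputOn {ι μ : Type} [Fintype ι] [Fintype μ] (S : ControlSystem ι μ) (r : ℕ)
    (Ω : Set (ControlJet ι μ r)) (h : ControlJet ι μ r → μ → ℝ) : Prop :=
  IsOpen Ω ∧ ContDiffOn ℝ ∞ h Ω ∧
  ∃ (s : ℕ) (W : Set (ℝ × (Fin (s + 1) → μ → ℝ)))
    (F : ℝ × (Fin (s + 1) → μ → ℝ) → (ι → ℝ) × (μ → ℝ)),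
    IsOpen W ∧ ContDiffOn ℝ ∞ F W ∧
    (∀ (c d : ℝ) (x : ℝ → ι → ℝ) (u : ℝ → μ → ℝ),
      IsTrajectory S (Set.Ioo c d) x u →
      (∀ t ∈ Set.Ioo c d, (t, x t, jet r u t) ∈ Ω) →
      ∀ t ∈ Set.Ioo c d,
        (t, jet s (fun τ => h (τ, x τ, jet r u τ)) t) ∈ W ∧
        F (t, jet s (fun τ => h (τ, x τ, jet r u τ)) t) = (x t, u t)) ∧
    (∀ (c d : ℝ) (y : ℝ → μ → ℝ), ContDiffOn ℝ ∞ y (Set.Ioo c d) →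
      (∀ t ∈ Set.Ioo c d, (t, jet s y t) ∈ W) →
      IsTrajectory S (Set.Ioo c d) (fun t => (F (t, jet s y t)).1)
        (fun t => (F (t, jet s y t)).2) ∧
      ∀ t ∈ Set.Ioo c d,
        (t, (F (t, jet s y t)).1, jet r (fun τ => (F (τ, jet s y τ)).2) t) ∈ Ω ∧
        h (t, (F (t, jet s y t)).1, jet r (fun τ => (F (τ, jet s y τ)).2) t) = y t)

/-- A control system is (differentially) flat: on an open dense set of jets of some order it has,
locally, a flat output. -/
def IsFlat {ι μ : Type} [Fintype ι] [Fintype μ] (S : ControlSystem ι μ) : Prop :=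
  ∃ (r : ℕ) (D : Set (ControlJet ι μ r)), IsOpen D ∧ Dense D ∧
    ∀ p ∈ D, ∃ (Ω : Set (ControlJet ι μ r)) (h : ControlJet ι μ r → μ → ℝ),
      p ∈ Ω ∧ IsFlatOutputOn S r Ω h

/-- The under-actuated ship, with states `(x, y, θ, z)` and controls `(u₁, u₂)`:
`ẋ = u₁ cos θ - z sin θ`, `ẏ = u₁ sin θ + z cos θ`, `θ̇ = u₂`, `ż = -u₁ u₂ - z`. -/
def ship : ControlSystem (Fin 4) (Fin 2) := fun _ X u =>
  ![u 0 * Real.cos (X 2) - X 3 * Real.sin (X 2),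
    u 0 * Real.sin (X 2) + X 3 * Real.cos (X 2),
    u 1,
    -(u 0 * u 1) - X 3]

/-- The ship after `k` prolongations of `u₂`. For `k = 4` the states are
`(x, y, θ, z, u₂, v₁, v₂, v₃)` and the controls are `(u₁, v₄)`. -/
def shipPr (k : ℕ) : ControlSystem (Fin (4 + k)) (Fin 2) := prolongIter ship 1 k

/-- The function `a (x, y, θ, z, u₂, v₁)`. -/
def outputA (x y θ z u₂ v₁ : ℝ) : ℝ :=
  (2 * y * u₂ ^ 2 - x * (v₁ + u₂)) * Real.sin θ +
    (2 * x * u₂ ^ 2 + y * (v₁ + u₂)) * Real.cos θ + 2 * z * u₂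

/-- `ℓ = s₁² + 4 s₁⁴ + 2 s₁ s₃ - 3 s₂²`. -/
def ell (s₁ s₂ s₃ : ℝ) : ℝ := s₁ ^ 2 + 4 * s₁ ^ 4 + 2 * s₁ * s₃ - 3 * s₂ ^ 2

/-- The points of the four-fold prolongation at which `ℓ (u₂, v₁, v₂) ≠ 0`. -/
def regularSet : Set (Phase (Fin 8) (Fin 2)) :=
  {p | ell (p.2.1 4) (p.2.1 5) (p.2.1 6) ≠ 0}

/-- The signature `⟨0, 0, 1, 0, 1⟩`. -/
abbrev shipSig : Fin 5 → ℕ := ![0, 0, 1, 0, 1]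

/-- The functions to be differentiated: `a` for the dependent variable of order three, `θ` for the
one of order five. -/
def shipOutputs (j : SigIndex shipSig) (p : Phase (Fin 8) (Fin 2)) : ℝ :=
  if sigOrder shipSig j = 3 then
    outputA (p.2.1 0) (p.2.1 1) (p.2.1 2) (p.2.1 3) (p.2.1 4) (p.2.1 5)
  else p.2.1 2

/-- The jets `(t, x, u, u̇, ü)` of the ship at which `ℓ (u₂, u̇₂, ü₂) ≠ 0`. -/
def regularJets : Set (ControlJet (Fin 4) (Fin 2) 2) :=
  {p | ell (p.2.2 0 1) (p.2.2 1 1) (p.2.2 2 1) ≠ 0}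

/-- The pair `(a, θ)` as a function of `(t, x, u, u̇, ü)`. -/
def shipFlatOutput (p : ControlJet (Fin 4) (Fin 2) 2) : Fin 2 → ℝ :=
  ![outputA (p.2.1 0) (p.2.1 1) (p.2.1 2) (p.2.1 3) (p.2.2 0 1) (p.2.2 1 1), p.2.1 2]

end ShipControl

end

/-! Linearization. In the body frame, with `p = x cos θ + y sin θ` and `q = y cos θ - x sin θ`, the
ship reads `ṗ = u₁ + u₂ q`, `q̇ = z - u₂ p`, `ż = -u₁ u₂ - z`. The control `u₁` moves `(p, q, z)`
along `(1, 0, -u₂)`, so the derivatives of `q` and of `z + u₂ p` are free of it. The outputs `a` and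
`ȧ` are linear combinations of exactly these two quantities, with coefficients in the jet of `u₂`
and determinant `-ℓ`. Next, `ä` is `-ℓ p` plus a combination of the same two, and the third
derivative is `-ℓ u₁` plus terms without `u₁`. Hence where `ℓ ≠ 0` the jet of `(a, θ)` determines
`q`, `z + u₂ p`, `p` and `u₁` by rational formulas (`recSway_eq` to `recU_eq`), and these formulas
solve the equations for arbitrary jets (`jetA₀_rec` to `jetA₃_rec`). This inverts the contact map.

Obstruction. The control directions generate a filtration in which a bracket with `T` costs one
level and brackets inside a level are free. In a Brunovsky form the fields of level `m` see only the
control and the `m` highest states of each chain, so their rank is at most `m + 1` times the number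
of controls (`ControlField.card_le`). For fewer than four prolongations some level has rank larger
than that: a direction of the `u₂`-chain does not commute with `[∂_{u₁}, T]` or `[[∂_{u₁}, T], T]`,
and their bracket is a multiple of `∂_z`. After four prolongations the chain reaches only `∂_{v₂}`
at level two, on which neither field depends.

Flatness. A trajectory of the ship lifts to the prolonged system, so the same formulas recover it
from the jet of `(a, θ)`. Conversely, given a curve `(a, θ)`, let `(p, q, z)` be recovered from its
jets. The errors of `ṗ`, `q̇`, `ż` in the equations of the ship satisfy the homogeneous linear
system whose only solution is zero when `ℓ ≠ 0` (`hasDerivAt_rec`). -/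

noncomputable section

/-! ### Distributions and static feedback transformations -/

namespace ShipControl

variable {ι μ ι' μ' : Type}

/-- The distribution is the common kernel of the forms `dx - f dt`; this replaces spans by one
equation. -/
theorem mem_distribution {S : ControlSystem ι μ} {p v : Phase ι μ} :
    v ∈ distribution S p ↔ v.2.1 = v.1 • S p.1 p.2.1 p.2.2 := by
  constructor
  · intro hv
    induction hv using Submodule.span_induction with
    | mem x hx =>
      rcases hx with rfl | ⟨w, rfl⟩ <;> simp [totalField]
    | zero => simp
    | add x y _ _ hx hy => simp [hx, hy, add_smul]
    | smul c x _ hx => simp [hx, mul_smul]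
  · intro hv
    have h : v = v.1 • totalField S p + ((0, 0, v.2.2) : Phase ι μ) := by
      ext <;> simp [totalField, hv]
    rw [h]
    exact add_mem (Submodule.smul_mem _ _ (Submodule.subset_span (Or.inl rfl)))
      (Submodule.subset_span (Or.inr ⟨v.2.2, rfl⟩))

/-- The fibre of the distribution is parametrised by the coefficient of `T` and the controls. -/
def distributionEquiv (S : ControlSystem ι μ) (p : Phase ι μ) :
    distribution S p ≃ₗ[ℝ] ℝ × (μ → ℝ) where
  toFun v := (v.1.1, v.1.2.2)
  map_add' _ _ := rfl
  map_smul' _ _ := rfl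
  invFun w := ⟨(w.1, w.1 • S p.1 p.2.1 p.2.2, w.2), mem_distribution.2 rfl⟩
  left_inv v := by
    apply Subtype.ext
    have := mem_distribution.1 v.2
    ext <;> simp [this]
  right_inv _ := rfl

theorem finrank_distribution [Fintype μ] (S : ControlSystem ι μ) (p : Phase ι μ) :
    Module.finrank ℝ (distribution S p) = 1 + Fintype.card μ := by
  rw [(distributionEquiv S p).finrank_eq]
  simp

section

variable [Fintype ι] [Fintype μ] [Fintype ι'] [Fintype μ']

theorem hasFDerivAt_of_mem_source {E F : Type*} [NormedAddCommGroup E] [NormedSpace ℝ E]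
    [NormedAddCommGroup F] [NormedSpace ℝ F] {Φ : OpenPartialHomeomorph E F}
    (h : ContDiffOn ℝ ∞ Φ Φ.source) {p : E} (hp : p ∈ Φ.source) :
    HasFDerivAt Φ (fderiv ℝ Φ p) p :=
  ((h.contDiffAt (Φ.open_source.mem_nhds hp)).differentiableAt (by simp)).hasFDerivAt

/-- Differentiating `Φ⁻¹ ∘ Φ = id` gives a left inverse of the differential. -/
theorem fderiv_injective_of_smooth {E F : Type*} [NormedAddCommGroup E] [NormedSpace ℝ E]
    [NormedAddCommGroup F] [NormedSpace ℝ F] {Φ : OpenPartialHomeomorph E F}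
    (h : ContDiffOn ℝ ∞ Φ Φ.source) (h' : ContDiffOn ℝ ∞ Φ.symm Φ.target) {p : E}
    (hp : p ∈ Φ.source) : Function.Injective (fderiv ℝ Φ p) := by
  have h1 := hasFDerivAt_of_mem_source h hp
  have h2 : HasFDerivAt Φ.symm (fderiv ℝ Φ.symm (Φ p)) (Φ p) :=
    hasFDerivAt_of_mem_source (Φ := Φ.symm) h' (Φ.map_source hp)
  have h3 : HasFDerivAt (fun x => x) ((fderiv ℝ Φ.symm (Φ p)).comp (fderiv ℝ Φ p)) p :=
    (h2.comp p h1).congr_of_eventuallyEq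
      (Filter.eventually_of_mem (Φ.open_source.mem_nhds hp) fun x hx => (Φ.left_inv hx).symm)
  have h4 := h3.unique (hasFDerivAt_id p)
  intro v w hvw
  have := congrArg (fderiv ℝ Φ.symm (Φ p)) hvw
  simpa [← ContinuousLinearMap.comp_apply, h4] using this

/-- A map that preserves time has a differential that preserves the `∂_t`-component. -/
theorem fderiv_fst_of_form {Φ : OpenPartialHomeomorph (Phase ι μ) (Phase ι' μ')}
    (hs : ContDiffOn ℝ ∞ Φ Φ.source) (hf : ∀ p ∈ Φ.source, (Φ p).1 = p.1) {p : Phase ι μ}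
    (hp : p ∈ Φ.source) (v : Phase ι μ) : (fderiv ℝ Φ p v).1 = v.1 := by
  have h1 := (hasFDerivAt_of_mem_source hs hp).fst
  have h2 : HasFDerivAt (fun x : Phase ι μ => (Φ x).1) (ContinuousLinearMap.fst ℝ ℝ _) p :=
    hasFDerivAt_fst.congr_of_eventuallyEq
      (Filter.eventually_of_mem (Φ.open_source.mem_nhds hp) hf)
  exact congrArg (fun L => L v) (h1.unique h2)

/-- The new states of a static feedback transformation do not depend on the controls. -/
theorem fderiv_control_of_form {Φ : OpenPartialHomeomorph (Phase ι μ) (Phase ι' μ')}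
    (hs : ContDiffOn ℝ ∞ Φ Φ.source) {α : ℝ → (ι → ℝ) → (ι' → ℝ)}
    (hf : ∀ p ∈ Φ.source, (Φ p).2.1 = α p.1 p.2.1) {p : Phase ι μ}
    (hp : p ∈ Φ.source) (w : μ → ℝ) : (fderiv ℝ Φ p (0, 0, w)).2.1 = 0 := by
  have h1 := (hasFDerivAt_of_mem_source hs hp).snd.fst
  have hγ : HasDerivAt (fun s : ℝ => p + s • ((0, 0, w) : Phase ι μ)) (0, 0, w) 0 := by
    simpa using ((hasDerivAt_id (0 : ℝ)).smul_const ((0, 0, w) : Phase ι μ)).const_add p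
  have hp0 : p + (0 : ℝ) • ((0, 0, w) : Phase ι μ) = p := by simp
  have h2 := HasFDerivAt.comp_hasDerivAt (0 : ℝ) (hp0.symm ▸ h1) hγ
  -- Along the line `p + s (0, 0, w)` time and states are fixed, so as long as the line stays in the
  -- open source the new states keep the value of `α`.
  have h3 : HasDerivAt (fun _ : ℝ => α p.1 p.2.1) 0 0 := hasDerivAt_const _ _
  have key : (fderiv ℝ Φ (p + (0 : ℝ) • ((0, 0, w) : Phase ι μ)) (0, 0, w)).2.1 = 0 := by
    refine h2.unique (h3.congr_of_eventuallyEq ?_)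
    have : ∀ᶠ s in 𝓝 (0 : ℝ), p + s • ((0, 0, w) : Phase ι μ) ∈ Φ.source :=
      hγ.continuousAt.eventually_mem (Φ.open_source.mem_nhds (by simpa using hp))
    filter_upwards [this] with s hs
    simpa using hf _ hs
  rwa [hp0] at key

namespace IsStaticFeedback

variable {S : ControlSystem ι μ} {S' : ControlSystem ι' μ'}
  {Φ : OpenPartialHomeomorph (Phase ι μ) (Phase ι' μ')}

/-- The injective differential preserves the rank of the distribution, which is one more than the
number of controls. It fixes the number of chains of any candidate normal form. -/
theorem card_control_eq (h : IsStaticFeedback S S' Φ) {p : Phase ι μ} (hp : p ∈ Φ.source) :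
    Fintype.card μ = Fintype.card μ' := by
  have h1 := congrArg (fun V : Submodule ℝ (Phase ι' μ') => Module.finrank ℝ V)
    (h.map_distribution p hp)
  have h2 := (Submodule.equivMapOfInjective (fderiv ℝ Φ p : Phase ι μ →ₗ[ℝ] Phase ι' μ')
    (fderiv_injective_of_smooth h.smooth h.smooth_symm hp) (distribution S p)).finrank_eq
  simp only [← h2, finrank_distribution] at h1
  omega

/-- The image of `T` lies in the target distribution and has `∂_t`-coefficient one, so it is the
target `T` up to control directions. -/
theorem fderiv_totalField (h : IsStaticFeedback S S' Φ) {p : Phase ι μ} (hp : p ∈ Φ.source) :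
    (fderiv ℝ Φ p (totalField S p)).2.1 = S' (Φ p).1 (Φ p).2.1 (Φ p).2.2 := by
  obtain ⟨α, β, hf⟩ := h.form
  have h1 : fderiv ℝ Φ p (totalField S p) ∈ distribution S' (Φ p) := by
    rw [← h.map_distribution p hp]
    exact Submodule.mem_map_of_mem (Submodule.subset_span (Or.inl rfl))
  rw [mem_distribution.1 h1, fderiv_fst_of_form h.smooth
    (fun p hp => by rw [hf p.1 p.2.1 p.2.2 hp]) hp]
  simp [totalField]

/-- A diffeomorphism of static feedback form that maps `T` into the distribution of a system with
the same number of controls is a static feedback transformation. -/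
theorem of_totalField (hs : ContDiffOn ℝ ∞ Φ Φ.source) (hs' : ContDiffOn ℝ ∞ Φ.symm Φ.target)
    (hc : Fintype.card μ = Fintype.card μ')
    (hf : ∃ (α : ℝ → (ι → ℝ) → (ι' → ℝ)) (β : ℝ → (ι → ℝ) → (μ → ℝ) → (μ' → ℝ)),
      ∀ t x u, (t, x, u) ∈ Φ.source → Φ (t, x, u) = (t, α t x, β t x u))
    (hT : ∀ p ∈ Φ.source,
      (fderiv ℝ Φ p (totalField S p)).2.1 = S' (Φ p).1 (Φ p).2.1 (Φ p).2.2) :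
    IsStaticFeedback S S' Φ := by
  refine ⟨hs, hs', hf, fun p hp => ?_⟩
  obtain ⟨α, β, hf⟩ := hf
  have ht := fderiv_fst_of_form hs (fun p hp => by rw [hf p.1 p.2.1 p.2.2 hp]) hp
  -- One inclusion suffices, since both sides have rank one plus the number of controls.
  apply Submodule.eq_of_le_of_finrank_eq
  · rw [distribution, Submodule.map_span_le]
    rintro v (rfl | ⟨w, rfl⟩)
    · refine mem_distribution.2 ?_
      simp only [ContinuousLinearMap.coe_coe]
      rw [ht, hT p hp]
      simp [totalField]
    · refine mem_distribution.2 ?_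
      simp only [ContinuousLinearMap.coe_coe]
      rw [ht, fderiv_control_of_form (α := α) hs (fun p hp => by rw [hf p.1 p.2.1 p.2.2 hp]) hp]
      simp
  · rw [← (Submodule.equivMapOfInjective (fderiv ℝ Φ p : Phase ι μ →ₗ[ℝ] Phase ι' μ')
      (fderiv_injective_of_smooth hs hs' hp) (distribution S p)).finrank_eq,
      finrank_distribution, finrank_distribution, hc]

end IsStaticFeedback

end

end ShipControl

/-! ### The filtration by brackets and the rank obstruction -/

namespace ShipControl

open VectorField

variable {ι μ μ' : Type} [Fintype ι] [Fintype μ]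

/-- The filtration generated by the control directions under brackets, where a bracket with `T`
raises the level by one. -/
inductive ControlField (S : ControlSystem ι μ) : ℕ → (Phase ι μ → Phase ι μ) → Prop
  | control (w : μ → ℝ) : ControlField S 0 fun _ => (0, 0, w)
  | succ {m V} : ControlField S m V → ControlField S (m + 1) V
  | ad {m V} : ControlField S m V → ControlField S (m + 1) (lieBracket ℝ V (totalField S))
  | bracket {m V W} : ControlField S m V → ControlField S m W →
      ControlField S m (lieBracket ℝ V W)

/-- If `V f = 0`, `W f = g` and `V g = 0`, then `[V, W] f = 0`. -/
theorem fderiv_lieBracket_eq_zero {E : Type*} [NormedAddCommGroup E] [NormedSpace ℝ E]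
    {U : Set E} (hU : IsOpen U) {f g : E → ℝ} {V W : E → E} (hf : ContDiffOn ℝ ∞ f U)
    (hV : ContDiff ℝ ∞ V) (hW : ContDiff ℝ ∞ W) (hVf : ∀ x ∈ U, fderiv ℝ f x (V x) = 0)
    (hWf : ∀ x ∈ U, fderiv ℝ f x (W x) = g x) (hVg : ∀ x ∈ U, fderiv ℝ g x (V x) = 0) :
    ∀ x ∈ U, fderiv ℝ f x (lieBracket ℝ V W x) = 0 := by
  intro x hx
  -- `[V, W] f` is a difference of `V (W f)` and `W (V f)`. Near `x` the inner functions are `g` and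
  -- `0`, so both terms vanish.
  rw [fderiv_apply_lieBracket (hf.contDiffAt (hU.mem_nhds hx)) (n := ∞)
    (by rw [minSmoothness_of_isRCLikeNormedField]; exact WithTop.coe_le_coe.2 le_top)
    (hW.differentiable (by simp) x) (hV.differentiable (by simp) x)]
  have h1 : (fun x => fderiv ℝ f x (W x)) =ᶠ[𝓝 x] g :=
    Filter.eventually_of_mem (hU.mem_nhds hx) hWf
  have h2 : (fun x => fderiv ℝ f x (V x)) =ᶠ[𝓝 x] fun _ => 0 :=
    Filter.eventually_of_mem (hU.mem_nhds hx) hVf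
  rw [h1.fderiv_eq, h2.fderiv_eq, hVg x hx]
  simp

namespace ControlField

variable {S : ControlSystem ι μ} {m : ℕ} {V : Phase ι μ → Phase ι μ}

theorem contDiff (hS : ContDiff ℝ ∞ (totalField S)) (h : ControlField S m V) :
    ContDiff ℝ ∞ V := by
  induction h with
  | control w => exact contDiff_const
  | succ _ ih => exact ih
  | ad _ ih => exact ih.lieBracket_vectorField hS (by simp)
  | bracket _ _ ih ih' => exact ih.lieBracket_vectorField ih' (by simp)

/-- Fields of the filtration have no `∂_t`-component. -/
theorem fst_eq_zero (hS : ContDiff ℝ ∞ (totalField S)) (h : ControlField S m V)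
    (p : Phase ι μ) : (V p).1 = 0 := by
  have key : ∀ x ∈ Set.univ, fderiv ℝ (Prod.fst : Phase ι μ → ℝ) x (V x) = 0 := by
    induction h with
    | control w => intro p _; rw [fderiv_fst]; rfl
    | succ _ ih => exact ih
    | ad h ih =>
      -- The derivative of time along `T` is the constant one, which every field annihilates.
      exact fderiv_lieBracket_eq_zero isOpen_univ contDiff_fst.contDiffOn (h.contDiff hS) hS ih
        (g := fun _ => 1) (fun x _ => by rw [fderiv_fst]; rfl) (by simp)
    | bracket h h' ih ih' =>
      exact fderiv_lieBracket_eq_zero isOpen_univ contDiff_fst.contDiffOn (h.contDiff hS)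
        (h'.contDiff hS) ih ih' (by simp)
  simpa [fderiv_fst] using key p trivial

/-- The state variables that a static feedback transformation pulls back from a Brunovsky form are
annihilated by the fields of level `m`, except for the `m` highest ones of each chain. -/
theorem fderiv_state_eq_zero [Fintype μ'] {κ : μ' → ℕ}
    {Φ : OpenPartialHomeomorph (Phase ι μ) (Phase (Σ j, Fin (κ j)) μ')}
    (hS : ContDiff ℝ ∞ (totalField S)) (hΦ : IsStaticFeedback S (brunovsky κ) Φ)
    (h : ControlField S m V) (q : Σ j, Fin (κ j)) (hq : q.2 + m < κ q.1) {p : Phase ι μ}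
    (hp : p ∈ Φ.source) : (fderiv ℝ Φ p (V p)).2.1 q = 0 := by
  obtain ⟨α, β, hf⟩ := hΦ.form
  have hz : ∀ q : Σ j, Fin (κ j), ContDiffOn ℝ ∞ (fun x => (Φ x).2.1 q) Φ.source := fun q =>
    contDiffOn_pi.1 hΦ.smooth.snd.fst q
  have hfd : ∀ q : Σ j, Fin (κ j), ∀ x ∈ Φ.source, ∀ v,
      fderiv ℝ (fun x => (Φ x).2.1 q) x v = (fderiv ℝ Φ x v).2.1 q := fun q x hx v =>
    congrArg (fun L => L v)
      (hasFDerivAt_pi'.1 (hasFDerivAt_of_mem_source hΦ.smooth hx).snd.fst q).fderiv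
  -- The claim must hold for all `q` at once: since `T z_i = z_{i+1}`, a bracket with `T` uses the
  -- induction hypothesis for both `z_i` and `z_{i+1}`, which is where one level is lost.
  suffices key : ∀ q : Σ j, Fin (κ j), q.2 + m < κ q.1 →
      ∀ x ∈ Φ.source, fderiv ℝ (fun x => (Φ x).2.1 q) x (V x) = 0 by
    rw [← hfd q p hp]
    exact key q hq p hp
  clear hq q
  induction h with
  | control w =>
    intro q _ x hx
    rw [hfd q x hx, fderiv_control_of_form (α := α) hΦ.smooth
      (fun p hp => by rw [hf p.1 p.2.1 p.2.2 hp]) hx]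
    rfl
  | succ _ ih => exact fun q hq => ih q (by omega)
  | ad h ih =>
    intro q hq
    have hq1 : (q.2 : ℕ) + 1 < κ q.1 := by omega
    refine fderiv_lieBracket_eq_zero Φ.open_source (hz q) (h.contDiff hS) hS (ih q (by omega))
      (fun x hx => ?_) (ih ⟨q.1, ⟨q.2 + 1, hq1⟩⟩ (by simp only; omega))
    rw [hfd q x hx, hΦ.fderiv_totalField hx]
    simp only [brunovsky, dif_pos hq1]
  | bracket h h' ih ih' =>
    intro q hq
    exact fderiv_lieBracket_eq_zero Φ.open_source (hz q) (h.contDiff hS) (h'.contDiff hS)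
      (ih q hq) (ih' q hq) (by simp)

/-- The rank of level `m` of the filtration of a linearizable system with `c` controls is at most
`(m + 1) c`. -/
theorem card_le [Fintype μ'] {κ : μ' → ℕ}
    {Φ : OpenPartialHomeomorph (Phase ι μ) (Phase (Σ j, Fin (κ j)) μ')}
    (hS : ContDiff ℝ ∞ (totalField S)) (hΦ : IsStaticFeedback S (brunovsky κ) Φ)
    {N : ℕ} {V : Fin N → Phase ι μ → Phase ι μ} (h : ∀ i, ControlField S m (V i))
    {p : Phase ι μ} (hp : p ∈ Φ.source) (hV : LinearIndependent ℝ fun i => V i p) :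
    N ≤ (m + 1) * Fintype.card μ := by
  classical
  obtain ⟨α, β, hf⟩ := hΦ.form
  -- `L` reads off what level `m` can see. The index `r = 0` gives the control of the chain and `1 ≤
  -- r ≤ κ` gives the `r`-th highest state; beyond the length of the chain the control is repeated
  -- as a harmless default.
  let L : Phase (Σ j, Fin (κ j)) μ' →ₗ[ℝ] (Fin (m + 1) × μ' → ℝ) :=
    LinearMap.pi fun r =>
      if h : 0 < (r.1 : ℕ) ∧ (r.1 : ℕ) ≤ κ r.2 then
        LinearMap.proj (⟨r.2, ⟨κ r.2 - r.1, by omega⟩⟩ : Σ j, Fin (κ j)) ∘ₗ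
          LinearMap.fst ℝ _ _ ∘ₗ LinearMap.snd ℝ _ _
      else LinearMap.proj r.2 ∘ₗ LinearMap.snd ℝ _ _ ∘ₗ LinearMap.snd ℝ _ _
  have hL : ∀ v : Phase (Σ j, Fin (κ j)) μ', v.1 = 0 →
      (∀ q : Σ j, Fin (κ j), q.2 + m < κ q.1 → v.2.1 q = 0) → L v = 0 → v = 0 := by
    intro v hv1 hv2 hLv
    have hL' : ∀ r, L v r = 0 := fun r => by rw [hLv]; rfl
    refine Prod.ext hv1 (Prod.ext (funext fun q => ?_) (funext fun j => ?_))
    · by_cases hq : (q.2 : ℕ) + m < κ q.1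
      · exact hv2 q hq
      · obtain ⟨j, i⟩ := q
        simp only at hq
        have hi := i.2
        have h1 := hL' (⟨κ j - i, by omega⟩, j)
        have h2 : 0 < κ j - (i : ℕ) ∧ κ j - (i : ℕ) ≤ κ j := by omega
        have h3 : κ j - (κ j - (i : ℕ)) = i := by omega
        simp only [L, LinearMap.pi_apply, dif_pos h2] at h1
        simpa [h3] using h1
    · simpa [L] using hL' (0, j)
  -- Combinations of the images of the `V i` have no time component and vanish on the low states, so
  -- `L` is injective on them.
  have hli : LinearIndependent ℝ fun i => L (fderiv ℝ Φ p (V i p)) := by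
    rw [Fintype.linearIndependent_iff] at hV ⊢
    intro c hc
    refine hV c ?_
    apply fderiv_injective_of_smooth hΦ.smooth hΦ.smooth_symm hp
    rw [map_zero]
    have e : ∑ i, c i • L (fderiv ℝ Φ p (V i p)) = L (fderiv ℝ Φ p (∑ i, c i • V i p)) := by
      simp
    refine hL _ ?_ (fun q hq => ?_) (e ▸ hc)
    · rw [fderiv_fst_of_form hΦ.smooth (fun p hp => by rw [hf p.1 p.2.1 p.2.2 hp]) hp,
        Prod.fst_sum]
      exact Finset.sum_eq_zero fun i _ => by simp [(h i).fst_eq_zero hS p]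
    · rw [map_sum, Prod.snd_sum, Prod.fst_sum, Finset.sum_apply]
      refine Finset.sum_eq_zero fun i _ => ?_
      simp [(h i).fderiv_state_eq_zero hS hΦ q hq hp]
  have := hli.fintype_card_le_finrank
  rw [hΦ.card_control_eq hp]
  simpa using this

end ControlField

/-- If at points arbitrarily close to `p` the fields of level `m` span more than `(m + 1) c`
dimensions, where `c` is the number of controls, then the system is not linearizable near `p`. -/
theorem not_staticFeedbackLinearizableAt {S : ControlSystem ι μ}
    (hS : ContDiff ℝ ∞ (totalField S)) {m N : ℕ} {V : Fin N → Phase ι μ → Phase ι μ}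
    (h : ∀ i, ControlField S m (V i)) (hN : (m + 1) * Fintype.card μ < N)
    (hV : Dense {p | LinearIndependent ℝ fun i => V i p}) (p : Phase ι μ) :
    ¬ StaticFeedbackLinearizableAt S p := by
  rintro ⟨k, ρ, Φ, hp, hΦ⟩
  -- The rank bound holds at every point of the open source, so it may be violated at a point `p'`
  -- other than `p`.
  obtain ⟨p', hp', hi⟩ := hV.inter_open_nonempty _ Φ.open_source ⟨p, hp⟩
  exact absurd (ControlField.card_le hS hΦ h hp' hi) (by omega)

end ShipControl

/-! ### Derivatives along lines, and fewer than four prolongations -/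

namespace ShipControl

open VectorField Real

section

variable {ι μ : Type} [Fintype ι] [Fintype μ]

/-- The derivative of a field with components `(c, w, 0)` from the derivatives of the components of
`w` along lines. -/
theorem fderiv_stateField {c : ℝ} {w : Phase ι μ → ι → ℝ} (hw : ∀ i, ContDiff ℝ ∞ fun p => w p i)
    {p v : Phase ι μ} {d : ι → ℝ}
    (hd : ∀ i, HasDerivAt (fun s : ℝ => w (p + s • v) i) (d i) 0) :
    fderiv ℝ (fun p => ((c, w p, 0) : Phase ι μ)) p v = (0, d, 0) := by
  have hW : DifferentiableAt ℝ (fun p => ((c, w p, 0) : Phase ι μ)) p :=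
    (contDiff_const.prodMk ((contDiff_pi.2 hw).prodMk contDiff_const)).differentiable
      (by simp) p
  have hγ : HasDerivAt (fun s : ℝ => p + s • v) v 0 := by
    simpa using ((hasDerivAt_id (0 : ℝ)).smul_const v).const_add p
  have hp0 : p + (0 : ℝ) • v = p := by simp
  have h1 := HasFDerivAt.comp_hasDerivAt (0 : ℝ) (hp0.symm ▸ hW.hasFDerivAt) hγ
  rw [hp0] at h1
  exact h1.unique ((hasDerivAt_const (0 : ℝ) c).prodMk
    ((hasDerivAt_pi.2 hd).prodMk (hasDerivAt_const (0 : ℝ) (0 : μ → ℝ))))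

end

section

variable (a a' b b' c dc θ θ' : ℝ)

theorem hasDerivAt_line : HasDerivAt (fun s : ℝ => a + s * a') a' 0 := by
  simpa using ((hasDerivAt_id (0 : ℝ)).mul_const a').const_add a

theorem hasDerivAt_line_cos :
    HasDerivAt (fun s : ℝ => cos (θ + s * θ')) (-sin θ * θ') 0 := by
  simpa using (hasDerivAt_line θ θ').cos

theorem hasDerivAt_line_sin :
    HasDerivAt (fun s : ℝ => sin (θ + s * θ')) (cos θ * θ') 0 := by
  simpa using (hasDerivAt_line θ θ').sin

/-- The values at zero are separate arguments so that the derivative comes out in simplified form,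
without terms `0 * a'`. -/
theorem hasDerivAt_line_mul {f g : ℝ → ℝ} {f' g' f₀ g₀ : ℝ} (hf : HasDerivAt f f' 0)
    (hg : HasDerivAt g g' 0) (hf₀ : f 0 = f₀) (hg₀ : g 0 = g₀) :
    HasDerivAt (fun s => f s * g s) (f' * g₀ + f₀ * g') 0 := by
  subst hf₀ hg₀
  exact hf.mul hg

theorem hasDerivAt_line_mul_cos : HasDerivAt (fun s : ℝ => (a + s * a') * cos (θ + s * θ'))
    (a' * cos θ + a * (-sin θ * θ')) 0 :=
  hasDerivAt_line_mul (hasDerivAt_line a a') (hasDerivAt_line_cos θ θ') (by simp) (by simp)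

theorem hasDerivAt_line_mul_sin : HasDerivAt (fun s : ℝ => (a + s * a') * sin (θ + s * θ'))
    (a' * sin θ + a * (cos θ * θ')) 0 :=
  hasDerivAt_line_mul (hasDerivAt_line a a') (hasDerivAt_line_sin θ θ') (by simp) (by simp)

theorem hasDerivAt_line_vel_x :
    HasDerivAt (fun s : ℝ => (a + s * a') * cos (θ + s * θ') - (b + s * b') * sin (θ + s * θ'))
      (a' * cos θ + a * (-sin θ * θ') - (b' * sin θ + b * (cos θ * θ'))) 0 :=
  (hasDerivAt_line_mul_cos a a' θ θ').sub (hasDerivAt_line_mul_sin b b' θ θ')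

theorem hasDerivAt_line_vel_y :
    HasDerivAt (fun s : ℝ => (a + s * a') * sin (θ + s * θ') + (b + s * b') * cos (θ + s * θ'))
      (a' * sin θ + a * (cos θ * θ') + (b' * cos θ + b * (-sin θ * θ'))) 0 :=
  (hasDerivAt_line_mul_sin a a' θ θ').add (hasDerivAt_line_mul_cos b b' θ θ')

theorem hasDerivAt_line_vel_z :
    HasDerivAt (fun s : ℝ => -((a + s * a') * (b + s * b')) - (c + s * dc))
      (-(a' * b + a * b') - dc) 0 :=
  (hasDerivAt_line_mul (hasDerivAt_line a a') (hasDerivAt_line b b') (by simp)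
    (by simp)).neg.sub (hasDerivAt_line c dc)

end

/-- A function that is a nonzero polynomial along some line through each point is nonzero on a dense
set. -/
theorem dense_ne_zero_of_polynomial {E : Type*} [NormedAddCommGroup E] [NormedSpace ℝ E]
    {f : E → ℝ} (h : ∀ p, ∃ (e : E) (P : Polynomial ℝ), P ≠ 0 ∧ ∀ s : ℝ, f (p + s • e) = P.eval s) :
    Dense {p | f p ≠ 0} := by
  intro p
  obtain ⟨e, P, hP, hf⟩ := h p
  have hd : Dense {s : ℝ | P.eval s ≠ 0} := by
    have hfin : {s : ℝ | P.eval s = 0}.Finite :=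
      (P.roots.toFinset.finite_toSet).subset fun s hs => by
        simpa [hP] using hs
    exact hfin.countable.dense_compl ℝ
  -- A nonzero polynomial has finitely many roots, so `s = 0` is a limit of non-roots, and the line
  -- carries this limit to `p`.
  have h0 := image_closure_subset_closure_image (f := fun s : ℝ => p + s • e) (by fun_prop)
    ⟨0, hd 0, rfl⟩
  simp only [zero_smul, add_zero] at h0
  refine closure_mono ?_ h0
  rintro _ ⟨s, hs, rfl⟩
  simpa [hf] using hs

theorem dense_state_ne_zero {ι μ : Type} [Fintype ι] [Fintype μ] [DecidableEq ι] (i : ι) :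
    Dense {p : Phase ι μ | p.2.1 i ≠ 0} := by
  refine dense_ne_zero_of_polynomial fun p =>
    ⟨(0, Pi.single i 1, 0), Polynomial.X + Polynomial.C (p.2.1 i), Polynomial.X_add_C_ne_zero _,
      fun s => ?_⟩
  simp [add_comm]

theorem lieBracket_const_left {E : Type*} [NormedAddCommGroup E] [NormedSpace ℝ E] (v : E)
    (W : E → E) (p : E) : lieBracket ℝ (fun _ => v) W p = fderiv ℝ W p v := by
  simp [lieBracket]

/-- Bracketing with a constant field is a directional derivative, so members of the filtration are
obtained from their formulas. -/
theorem ControlField.ad_const {ι μ : Type} [Fintype ι] [Fintype μ] {S : ControlSystem ι μ} {m : ℕ}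
    {v : Phase ι μ} {W : Phase ι μ → Phase ι μ} (h : ControlField S m fun _ => v)
    (hW : ∀ p, fderiv ℝ (totalField S) p v = W p) : ControlField S (m + 1) W :=
  (funext fun p => (lieBracket_const_left v (totalField S) p).trans (hW p)) ▸ h.ad

theorem ControlField.bracket_const {ι μ : Type} [Fintype ι] [Fintype μ] {S : ControlSystem ι μ}
    {m : ℕ} {v : Phase ι μ} {V W : Phase ι μ → Phase ι μ} (h : ControlField S m fun _ => v)
    (hV : ControlField S m V) (hW : ∀ p, fderiv ℝ V p v = W p) : ControlField S m W :=
  (funext fun p => (lieBracket_const_left v V p).trans (hW p)) ▸ h.bracket hV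

/-- A combination of the directions `(cos θ, sin θ)` and `(sin θ, -cos θ)` that vanishes. -/
theorem eq_zero_of_rotation {θ a b : ℝ} (h₁ : a * cos θ + b * sin θ = 0)
    (h₂ : a * sin θ - b * cos θ = 0) : a = 0 ∧ b = 0 := by
  have h := sin_sq_add_cos_sq θ
  constructor
  · linear_combination cos θ * h₁ + sin θ * h₂ - a * h
  · linear_combination sin θ * h₁ - cos θ * h₂ - b * h

/-! ### No prolongation -/

theorem totalField_shipPr_zero : totalField (shipPr 0) = fun p : Phase (Fin 4) (Fin 2) =>
    (1, ![p.2.2 0 * cos (p.2.1 2) - p.2.1 3 * sin (p.2.1 2),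
      p.2.2 0 * sin (p.2.1 2) + p.2.1 3 * cos (p.2.1 2), p.2.2 1,
      -(p.2.2 0 * p.2.2 1) - p.2.1 3], 0) := by
  funext p
  refine Prod.ext rfl (Prod.ext (funext fun i => ?_) rfl)
  fin_cases i <;> rfl

theorem contDiff_totalField_shipPr_zero : ContDiff ℝ ∞ (totalField (shipPr 0)) := by
  rw [totalField_shipPr_zero]
  refine contDiff_const.prodMk ((contDiff_pi.2 fun i => ?_).prodMk contDiff_const)
  fin_cases i <;> simp <;> fun_prop

theorem fderiv_totalField_shipPr_zero (p v : Phase (Fin 4) (Fin 2)) :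
    fderiv ℝ (totalField (shipPr 0)) p v =
    (0, ![v.2.2 0 * cos (p.2.1 2) + p.2.2 0 * (-sin (p.2.1 2) * v.2.1 2) -
        (v.2.1 3 * sin (p.2.1 2) + p.2.1 3 * (cos (p.2.1 2) * v.2.1 2)),
      v.2.2 0 * sin (p.2.1 2) + p.2.2 0 * (cos (p.2.1 2) * v.2.1 2) +
        (v.2.1 3 * cos (p.2.1 2) + p.2.1 3 * (-sin (p.2.1 2) * v.2.1 2)),
      v.2.2 1, -(v.2.2 0 * p.2.2 1 + p.2.2 0 * v.2.2 1) - v.2.1 3], 0) := by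
  rw [totalField_shipPr_zero]
  refine fderiv_stateField (fun i => ?_) fun i => ?_
  · fin_cases i <;> simp <;> fun_prop
  · fin_cases i
    · exact hasDerivAt_line_vel_x _ _ _ _ _ _
    · exact hasDerivAt_line_vel_y _ _ _ _ _ _
    · exact hasDerivAt_line _ _
    · exact hasDerivAt_line_vel_z _ _ _ _ _ _

/-- The field `[∂_{u₁}, T]`. -/
def surgeFieldZero (p : Phase (Fin 4) (Fin 2)) : Phase (Fin 4) (Fin 2) :=
  (0, ![cos (p.2.1 2), sin (p.2.1 2), 0, -p.2.2 1], 0)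

theorem lieBracket_surgeFieldZero :
    lieBracket ℝ (fun _ => (0, 0, ![1, 0])) (totalField (shipPr 0)) = surgeFieldZero := by
  funext p
  rw [lieBracket_const_left, fderiv_totalField_shipPr_zero]
  simp [surgeFieldZero]

theorem fderiv_surgeFieldZero (p v : Phase (Fin 4) (Fin 2)) :
    fderiv ℝ surgeFieldZero p v =
      (0, ![-sin (p.2.1 2) * v.2.1 2, cos (p.2.1 2) * v.2.1 2, 0, -v.2.2 1], 0) := by
  refine fderiv_stateField (fun i => ?_) fun i => ?_
  · fin_cases i <;> simp <;> fun_prop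
  · fin_cases i
    · exact hasDerivAt_line_cos _ _
    · exact hasDerivAt_line_sin _ _
    · exact hasDerivAt_const _ _
    · exact (hasDerivAt_line _ _).neg

/-- The field `[∂_{u₁}, T]` contains `-u₂ ∂_z`, so its bracket with `∂_{u₂}` is `-∂_z`. Level one
then has rank at least five, above the bound four. -/
theorem not_linearizable_shipPr_zero (p : Phase (Fin 4) (Fin 2)) :
    ¬ StaticFeedbackLinearizableAt (shipPr 0) p := by
  have c₁ : ControlField (shipPr 0) 0 fun _ => (0, 0, ![1, 0]) := .control _
  have c₂ : ControlField (shipPr 0) 0 fun _ => (0, 0, ![0, 1]) := .control _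
  have hs : ControlField (shipPr 0) 1 surgeFieldZero := lieBracket_surgeFieldZero ▸ c₁.ad
  have hy : ControlField (shipPr 0) 1 fun p => (0, ![0, 0, 1, -p.2.2 0], 0) :=
    c₂.ad_const fun p => by
      rw [fderiv_totalField_shipPr_zero]
      simp
  have hz : ControlField (shipPr 0) 1 fun _ => (0, ![0, 0, 0, -1], 0) :=
    c₂.succ.bracket_const hs fun p => by
      rw [fderiv_surgeFieldZero]
      simp
  refine not_staticFeedbackLinearizableAt (m := 1) (N := 5) contDiff_totalField_shipPr_zero
    (V := ![fun _ => (0, 0, ![1, 0]),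
      fun _ => (0, 0, ![0, 1]),
      surgeFieldZero,
      fun p => (0, ![0, 0, 1, -p.2.2 0], 0),
      fun _ => (0, ![0, 0, 0, -1], 0)])
    (fun i => ?_) (by simp) ?_ p
  · fin_cases i
    exacts [c₁.succ, c₂.succ, hs, hy, hz]
  · refine Dense.mono (fun p _ => ?_) dense_univ
    simp only [Set.mem_ofPred_eq]
    rw [Fintype.linearIndependent_iff]
    intro c hc
    have hx := fun i => congrFun (congrArg (fun v : Phase (Fin 4) (Fin 2) => v.2.1) hc) i
    have hu := fun i => congrFun (congrArg (fun v : Phase (Fin 4) (Fin 2) => v.2.2) hc) i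
    simp [Fin.sum_univ_succ, surgeFieldZero, Fin.forall_fin_succ] at hx hu ⊢
    obtain ⟨h₀, h₁, h₃, h₄⟩ := hx
    -- Only the third field has components along `x` and `y`; the cosine and the sine do not vanish
    -- together.
    have h₂ : c 2 = 0 := (eq_zero_of_rotation (θ := p.2.1 2) (b := 0)
      (by rcases h₀ with h | h <;> simp [h]) (by rcases h₁ with h | h <;> simp [h])).1
    refine ⟨hu.1, hu.2, h₂, h₃, ?_⟩
    simpa [h₂, h₃] using h₄

/-! ### One prolongation -/

theorem totalField_shipPr_one : totalField (shipPr 1) = fun p : Phase (Fin 5) (Fin 2) =>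
    (1, ![p.2.2 0 * cos (p.2.1 2) - p.2.1 3 * sin (p.2.1 2),
      p.2.2 0 * sin (p.2.1 2) + p.2.1 3 * cos (p.2.1 2), p.2.1 4,
      -(p.2.2 0 * p.2.1 4) - p.2.1 3, p.2.2 1], 0) := by
  funext p
  refine Prod.ext rfl (Prod.ext (funext fun i => ?_) rfl)
  fin_cases i <;> rfl

theorem contDiff_totalField_shipPr_one : ContDiff ℝ ∞ (totalField (shipPr 1)) := by
  rw [totalField_shipPr_one]
  refine contDiff_const.prodMk ((contDiff_pi.2 fun i => ?_).prodMk contDiff_const)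
  fin_cases i <;> simp <;> fun_prop

theorem fderiv_totalField_shipPr_one (p v : Phase (Fin 5) (Fin 2)) :
    fderiv ℝ (totalField (shipPr 1)) p v =
    (0, ![v.2.2 0 * cos (p.2.1 2) + p.2.2 0 * (-sin (p.2.1 2) * v.2.1 2) -
        (v.2.1 3 * sin (p.2.1 2) + p.2.1 3 * (cos (p.2.1 2) * v.2.1 2)),
      v.2.2 0 * sin (p.2.1 2) + p.2.2 0 * (cos (p.2.1 2) * v.2.1 2) +
        (v.2.1 3 * cos (p.2.1 2) + p.2.1 3 * (-sin (p.2.1 2) * v.2.1 2)),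
      v.2.1 4, -(v.2.2 0 * p.2.1 4 + p.2.2 0 * v.2.1 4) - v.2.1 3, v.2.2 1], 0) := by
  rw [totalField_shipPr_one]
  refine fderiv_stateField (fun i => ?_) fun i => ?_
  · fin_cases i <;> simp <;> fun_prop
  · fin_cases i
    · exact hasDerivAt_line_vel_x _ _ _ _ _ _
    · exact hasDerivAt_line_vel_y _ _ _ _ _ _
    · exact hasDerivAt_line _ _
    · exact hasDerivAt_line_vel_z _ _ _ _ _ _
    · exact hasDerivAt_line _ _

/-- The field `[∂_{u₁}, T]`. -/
def surgeFieldOne (p : Phase (Fin 5) (Fin 2)) : Phase (Fin 5) (Fin 2) :=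
  (0, ![cos (p.2.1 2), sin (p.2.1 2), 0, -p.2.1 4, 0], 0)

theorem lieBracket_surgeFieldOne :
    lieBracket ℝ (fun _ => (0, 0, ![1, 0])) (totalField (shipPr 1)) = surgeFieldOne := by
  funext p
  rw [lieBracket_const_left, fderiv_totalField_shipPr_one]
  simp [surgeFieldOne]

theorem fderiv_surgeFieldOne (p v : Phase (Fin 5) (Fin 2)) :
    fderiv ℝ surgeFieldOne p v =
      (0, ![-sin (p.2.1 2) * v.2.1 2, cos (p.2.1 2) * v.2.1 2, 0, -v.2.1 4, 0], 0) := by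
  refine fderiv_stateField (fun i => ?_) fun i => ?_
  · fin_cases i <;> simp <;> fun_prop
  · fin_cases i
    · exact hasDerivAt_line_cos _ _
    · exact hasDerivAt_line_sin _ _
    · exact hasDerivAt_const _ _
    · exact (hasDerivAt_line _ _).neg
    · exact hasDerivAt_const _ _

/-- Now `u₂` is a state, but `∂_{u₂}` is still reached at level one, as `[∂_{v₁}, T]`, and the same
bracket gives a fifth direction. -/
theorem not_linearizable_shipPr_one (p : Phase (Fin 5) (Fin 2)) :
    ¬ StaticFeedbackLinearizableAt (shipPr 1) p := by
  have c₁ : ControlField (shipPr 1) 0 fun _ => (0, 0, ![1, 0]) := .control _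
  have c₂ : ControlField (shipPr 1) 0 fun _ => (0, 0, ![0, 1]) := .control _
  have hs : ControlField (shipPr 1) 1 surgeFieldOne := lieBracket_surgeFieldOne ▸ c₁.ad
  have hy : ControlField (shipPr 1) 1 fun _ => (0, ![0, 0, 0, 0, 1], 0) :=
    c₂.ad_const fun p => by
      rw [fderiv_totalField_shipPr_one]
      simp
  have hz : ControlField (shipPr 1) 1 fun _ => (0, ![0, 0, 0, -1, 0], 0) :=
    hy.bracket_const hs fun p => by
      rw [fderiv_surgeFieldOne]
      simp
  refine not_staticFeedbackLinearizableAt (m := 1) (N := 5) contDiff_totalField_shipPr_one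
    (V := ![fun _ => (0, 0, ![1, 0]),
      fun _ => (0, 0, ![0, 1]),
      surgeFieldOne,
      fun _ => (0, ![0, 0, 0, 0, 1], 0),
      fun _ => (0, ![0, 0, 0, -1, 0], 0)])
    (fun i => ?_) (by simp) ?_ p
  · fin_cases i
    exacts [c₁.succ, c₂.succ, hs, hy, hz]
  · refine Dense.mono (fun p _ => ?_) dense_univ
    simp only [Set.mem_ofPred_eq]
    rw [Fintype.linearIndependent_iff]
    intro c hc
    have hx := fun i => congrFun (congrArg (fun v : Phase (Fin 5) (Fin 2) => v.2.1) hc) i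
    have hu := fun i => congrFun (congrArg (fun v : Phase (Fin 5) (Fin 2) => v.2.2) hc) i
    simp [Fin.sum_univ_succ, surgeFieldOne, Fin.forall_fin_succ] at hx hu ⊢
    obtain ⟨h₀, h₁, h₄, h₃⟩ := hx
    have h₂ : c 2 = 0 := (eq_zero_of_rotation (θ := p.2.1 2) (b := 0)
      (by rcases h₀ with h | h <;> simp [h]) (by rcases h₁ with h | h <;> simp [h])).1
    refine ⟨hu.1, hu.2, h₂, h₃, ?_⟩
    simpa [h₂, h₃] using h₄

/-! ### Two prolongations -/

theorem totalField_shipPr_two : totalField (shipPr 2) = fun p : Phase (Fin 6) (Fin 2) =>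
    (1, ![p.2.2 0 * cos (p.2.1 2) - p.2.1 3 * sin (p.2.1 2),
      p.2.2 0 * sin (p.2.1 2) + p.2.1 3 * cos (p.2.1 2), p.2.1 4,
      -(p.2.2 0 * p.2.1 4) - p.2.1 3, p.2.1 5, p.2.2 1], 0) := by
  funext p
  refine Prod.ext rfl (Prod.ext (funext fun i => ?_) rfl)
  fin_cases i <;> rfl

theorem contDiff_totalField_shipPr_two : ContDiff ℝ ∞ (totalField (shipPr 2)) := by
  rw [totalField_shipPr_two]
  refine contDiff_const.prodMk ((contDiff_pi.2 fun i => ?_).prodMk contDiff_const)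
  fin_cases i <;> simp <;> fun_prop

theorem fderiv_totalField_shipPr_two (p v : Phase (Fin 6) (Fin 2)) :
    fderiv ℝ (totalField (shipPr 2)) p v =
    (0, ![v.2.2 0 * cos (p.2.1 2) + p.2.2 0 * (-sin (p.2.1 2) * v.2.1 2) -
        (v.2.1 3 * sin (p.2.1 2) + p.2.1 3 * (cos (p.2.1 2) * v.2.1 2)),
      v.2.2 0 * sin (p.2.1 2) + p.2.2 0 * (cos (p.2.1 2) * v.2.1 2) +
        (v.2.1 3 * cos (p.2.1 2) + p.2.1 3 * (-sin (p.2.1 2) * v.2.1 2)),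
      v.2.1 4, -(v.2.2 0 * p.2.1 4 + p.2.2 0 * v.2.1 4) - v.2.1 3, v.2.1 5, v.2.2 1], 0) := by
  rw [totalField_shipPr_two]
  refine fderiv_stateField (fun i => ?_) fun i => ?_
  · fin_cases i <;> simp <;> fun_prop
  · fin_cases i
    · exact hasDerivAt_line_vel_x _ _ _ _ _ _
    · exact hasDerivAt_line_vel_y _ _ _ _ _ _
    · exact hasDerivAt_line _ _
    · exact hasDerivAt_line_vel_z _ _ _ _ _ _
    · exact hasDerivAt_line _ _
    · exact hasDerivAt_line _ _

/-- The field `[∂_{u₁}, T]`. -/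
def surgeFieldTwo (p : Phase (Fin 6) (Fin 2)) : Phase (Fin 6) (Fin 2) :=
  (0, ![cos (p.2.1 2), sin (p.2.1 2), 0, -p.2.1 4, 0, 0], 0)

theorem lieBracket_surgeFieldTwo :
    lieBracket ℝ (fun _ => (0, 0, ![1, 0])) (totalField (shipPr 2)) = surgeFieldTwo := by
  funext p
  rw [lieBracket_const_left, fderiv_totalField_shipPr_two]
  simp [surgeFieldTwo]

theorem fderiv_surgeFieldTwo (p v : Phase (Fin 6) (Fin 2)) :
    fderiv ℝ surgeFieldTwo p v =
      (0, ![-sin (p.2.1 2) * v.2.1 2, cos (p.2.1 2) * v.2.1 2, 0, -v.2.1 4, 0, 0], 0) := by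
  refine fderiv_stateField (fun i => ?_) fun i => ?_
  · fin_cases i <;> simp <;> fun_prop
  · fin_cases i
    · exact hasDerivAt_line_cos _ _
    · exact hasDerivAt_line_sin _ _
    · exact hasDerivAt_const _ _
    · exact (hasDerivAt_line _ _).neg
    · exact hasDerivAt_const _ _
    · exact hasDerivAt_const _ _

/-- The field `[[∂_{u₁}, T], T]`. -/
def swayFieldTwo (p : Phase (Fin 6) (Fin 2)) : Phase (Fin 6) (Fin 2) :=
  (0, ![2 * p.2.1 4 * sin (p.2.1 2), -(2 * p.2.1 4 * cos (p.2.1 2)), 0,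
    p.2.1 4 + p.2.1 5, 0, 0], 0)

theorem lieBracket_swayFieldTwo :
    lieBracket ℝ surgeFieldTwo (totalField (shipPr 2)) = swayFieldTwo := by
  funext p
  rw [lieBracket, fderiv_totalField_shipPr_two, fderiv_surgeFieldTwo, totalField_shipPr_two]
  refine Prod.ext ?_ (Prod.ext (funext fun i => ?_) ?_)
  · simp [swayFieldTwo]
  · fin_cases i <;> simp [swayFieldTwo, surgeFieldTwo] <;> ring
  · simp [swayFieldTwo]

/-- At level one the chain reaches only `∂_{v₁}`, which commutes with `[∂_{u₁}, T]`, so the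
obstruction moves to level two. There `∂_{u₂}` appears, its bracket with `[∂_{u₁}, T]` is again
`-∂_z`, and the rank is at least seven, above the bound six. -/
theorem not_linearizable_shipPr_two (p : Phase (Fin 6) (Fin 2)) :
    ¬ StaticFeedbackLinearizableAt (shipPr 2) p := by
  have c₁ : ControlField (shipPr 2) 0 fun _ => (0, 0, ![1, 0]) := .control _
  have c₂ : ControlField (shipPr 2) 0 fun _ => (0, 0, ![0, 1]) := .control _
  have hs : ControlField (shipPr 2) 1 surgeFieldTwo := lieBracket_surgeFieldTwo ▸ c₁.ad
  have hw : ControlField (shipPr 2) 2 swayFieldTwo := lieBracket_swayFieldTwo ▸ hs.ad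
  have hv : ControlField (shipPr 2) 1 fun _ => (0, ![0, 0, 0, 0, 0, 1], 0) :=
    c₂.ad_const fun p => by
      rw [fderiv_totalField_shipPr_two]
      simp
  have hy : ControlField (shipPr 2) 2 fun _ => (0, ![0, 0, 0, 0, 1, 0], 0) :=
    hv.ad_const fun p => by
      rw [fderiv_totalField_shipPr_two]
      simp
  have hz : ControlField (shipPr 2) 2 fun _ => (0, ![0, 0, 0, -1, 0, 0], 0) :=
    hy.bracket_const hs.succ fun p => by
      rw [fderiv_surgeFieldTwo]
      simp
  refine not_staticFeedbackLinearizableAt (m := 2) (N := 7) contDiff_totalField_shipPr_two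
    (V := ![fun _ => (0, 0, ![1, 0]),
      fun _ => (0, 0, ![0, 1]),
      surgeFieldTwo,
      fun _ => (0, ![0, 0, 0, 0, 0, 1], 0),
      swayFieldTwo,
      fun _ => (0, ![0, 0, 0, 0, 1, 0], 0),
      fun _ => (0, ![0, 0, 0, -1, 0, 0], 0)])
    (fun i => ?_) (by simp) ?_ p
  · fin_cases i
    exacts [c₁.succ.succ, c₂.succ.succ, hs.succ, hv.succ, hw, hy, hz]
  · refine Dense.mono (fun p hp => ?_) (dense_state_ne_zero (4 : Fin 6))
    simp only [Set.mem_ofPred_eq] at hp ⊢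
    rw [Fintype.linearIndependent_iff]
    intro c hc
    have hx := fun i => congrFun (congrArg (fun v : Phase (Fin 6) (Fin 2) => v.2.1) hc) i
    have hu := fun i => congrFun (congrArg (fun v : Phase (Fin 6) (Fin 2) => v.2.2) hc) i
    simp [Fin.sum_univ_succ, surgeFieldTwo, swayFieldTwo, Fin.forall_fin_succ] at hx hu ⊢
    obtain ⟨h₀, h₁, h₆, h₅, h₃⟩ := hx
    -- The horizontal parts of the two fields are orthogonal, the second one of length `2 |u₂|`;
    -- this is why the points with `u₂ ≠ 0` are used.
    obtain ⟨h₂, h⟩ := eq_zero_of_rotation (θ := p.2.1 2) (a := c 2) (b := 2 * c 4 * p.2.1 4)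
      (by linear_combination h₀) (by linear_combination h₁)
    have h₄ : c 4 = 0 := by simpa [hp] using h
    refine ⟨hu.1, hu.2, h₂, h₃, h₄, h₅, ?_⟩
    simpa [h₂, h₄] using h₆

/-! ### Three prolongations -/

theorem totalField_shipPr_three : totalField (shipPr 3) = fun p : Phase (Fin 7) (Fin 2) =>
    (1, ![p.2.2 0 * cos (p.2.1 2) - p.2.1 3 * sin (p.2.1 2),
      p.2.2 0 * sin (p.2.1 2) + p.2.1 3 * cos (p.2.1 2), p.2.1 4,
      -(p.2.2 0 * p.2.1 4) - p.2.1 3, p.2.1 5, p.2.1 6, p.2.2 1], 0) := by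
  funext p
  refine Prod.ext rfl (Prod.ext (funext fun i => ?_) rfl)
  fin_cases i <;> rfl

theorem contDiff_totalField_shipPr_three : ContDiff ℝ ∞ (totalField (shipPr 3)) := by
  rw [totalField_shipPr_three]
  refine contDiff_const.prodMk ((contDiff_pi.2 fun i => ?_).prodMk contDiff_const)
  fin_cases i <;> simp <;> fun_prop

theorem fderiv_totalField_shipPr_three (p v : Phase (Fin 7) (Fin 2)) :
    fderiv ℝ (totalField (shipPr 3)) p v =
    (0, ![v.2.2 0 * cos (p.2.1 2) + p.2.2 0 * (-sin (p.2.1 2) * v.2.1 2) -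
        (v.2.1 3 * sin (p.2.1 2) + p.2.1 3 * (cos (p.2.1 2) * v.2.1 2)),
      v.2.2 0 * sin (p.2.1 2) + p.2.2 0 * (cos (p.2.1 2) * v.2.1 2) +
        (v.2.1 3 * cos (p.2.1 2) + p.2.1 3 * (-sin (p.2.1 2) * v.2.1 2)),
      v.2.1 4, -(v.2.2 0 * p.2.1 4 + p.2.2 0 * v.2.1 4) - v.2.1 3, v.2.1 5, v.2.1 6, v.2.2 1], 0) := by
  rw [totalField_shipPr_three]
  refine fderiv_stateField (fun i => ?_) fun i => ?_
  · fin_cases i <;> simp <;> fun_prop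
  · fin_cases i
    · exact hasDerivAt_line_vel_x _ _ _ _ _ _
    · exact hasDerivAt_line_vel_y _ _ _ _ _ _
    · exact hasDerivAt_line _ _
    · exact hasDerivAt_line_vel_z _ _ _ _ _ _
    · exact hasDerivAt_line _ _
    · exact hasDerivAt_line _ _
    · exact hasDerivAt_line _ _

/-- The field `[∂_{u₁}, T]`. -/
def surgeFieldThree (p : Phase (Fin 7) (Fin 2)) : Phase (Fin 7) (Fin 2) :=
  (0, ![cos (p.2.1 2), sin (p.2.1 2), 0, -p.2.1 4, 0, 0, 0], 0)

theorem lieBracket_surgeFieldThree :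
    lieBracket ℝ (fun _ => (0, 0, ![1, 0])) (totalField (shipPr 3)) = surgeFieldThree := by
  funext p
  rw [lieBracket_const_left, fderiv_totalField_shipPr_three]
  simp [surgeFieldThree]

theorem fderiv_surgeFieldThree (p v : Phase (Fin 7) (Fin 2)) :
    fderiv ℝ surgeFieldThree p v =
      (0, ![-sin (p.2.1 2) * v.2.1 2, cos (p.2.1 2) * v.2.1 2, 0, -v.2.1 4, 0, 0, 0], 0) := by
  refine fderiv_stateField (fun i => ?_) fun i => ?_
  · fin_cases i <;> simp <;> fun_prop
  · fin_cases i
    · exact hasDerivAt_line_cos _ _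
    · exact hasDerivAt_line_sin _ _
    · exact hasDerivAt_const _ _
    · exact (hasDerivAt_line _ _).neg
    · exact hasDerivAt_const _ _
    · exact hasDerivAt_const _ _
    · exact hasDerivAt_const _ _

/-- The field `[[∂_{u₁}, T], T]`. -/
def swayFieldThree (p : Phase (Fin 7) (Fin 2)) : Phase (Fin 7) (Fin 2) :=
  (0, ![2 * p.2.1 4 * sin (p.2.1 2), -(2 * p.2.1 4 * cos (p.2.1 2)), 0,
    p.2.1 4 + p.2.1 5, 0, 0, 0], 0)

theorem lieBracket_swayFieldThree :
    lieBracket ℝ surgeFieldThree (totalField (shipPr 3)) = swayFieldThree := by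
  funext p
  rw [lieBracket, fderiv_totalField_shipPr_three, fderiv_surgeFieldThree, totalField_shipPr_three]
  refine Prod.ext ?_ (Prod.ext (funext fun i => ?_) ?_)
  · simp [swayFieldThree]
  · fin_cases i <;> simp [swayFieldThree, surgeFieldThree] <;> ring
  · simp [swayFieldThree]

theorem fderiv_swayFieldThree (p v : Phase (Fin 7) (Fin 2)) :
    fderiv ℝ swayFieldThree p v =
      (0, ![2 * v.2.1 4 * sin (p.2.1 2) + 2 * p.2.1 4 * (cos (p.2.1 2) * v.2.1 2),
        -(2 * v.2.1 4 * cos (p.2.1 2) + 2 * p.2.1 4 * (-sin (p.2.1 2) * v.2.1 2)), 0,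
        v.2.1 4 + v.2.1 5, 0, 0, 0], 0) := by
  refine fderiv_stateField (fun i => ?_) fun i => ?_
  · fin_cases i <;> simp <;> fun_prop
  · have h2 := (hasDerivAt_line (p.2.1 4) (v.2.1 4)).const_mul 2
    fin_cases i
    · exact hasDerivAt_line_mul h2 (hasDerivAt_line_sin _ _) (by simp) (by simp)
    · exact (hasDerivAt_line_mul h2 (hasDerivAt_line_cos _ _) (by simp) (by simp)).neg
    · exact hasDerivAt_const _ _
    · exact (hasDerivAt_line _ _).add (hasDerivAt_line _ _)
    · exact hasDerivAt_const _ _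
    · exact hasDerivAt_const _ _
    · exact hasDerivAt_const _ _

/-- Level two now reaches only `∂_{v₁}`, which commutes with `[∂_{u₁}, T]` but not with `[[∂_{u₁},
T], T]`: the latter contains `v₁ ∂_z`, and the bracket `∂_z` is the seventh direction. -/
theorem not_linearizable_shipPr_three (p : Phase (Fin 7) (Fin 2)) :
    ¬ StaticFeedbackLinearizableAt (shipPr 3) p := by
  have c₁ : ControlField (shipPr 3) 0 fun _ => (0, 0, ![1, 0]) := .control _
  have c₂ : ControlField (shipPr 3) 0 fun _ => (0, 0, ![0, 1]) := .control _
  have hs : ControlField (shipPr 3) 1 surgeFieldThree := lieBracket_surgeFieldThree ▸ c₁.ad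
  have hw : ControlField (shipPr 3) 2 swayFieldThree := lieBracket_swayFieldThree ▸ hs.ad
  have hv : ControlField (shipPr 3) 1 fun _ => (0, ![0, 0, 0, 0, 0, 0, 1], 0) :=
    c₂.ad_const fun p => by
      rw [fderiv_totalField_shipPr_three]
      simp
  have hy : ControlField (shipPr 3) 2 fun _ => (0, ![0, 0, 0, 0, 0, 1, 0], 0) :=
    hv.ad_const fun p => by
      rw [fderiv_totalField_shipPr_three]
      simp
  have hz : ControlField (shipPr 3) 2 fun _ => (0, ![0, 0, 0, 1, 0, 0, 0], 0) :=
    hy.bracket_const hw fun p => by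
      rw [fderiv_swayFieldThree]
      simp
  refine not_staticFeedbackLinearizableAt (m := 2) (N := 7) contDiff_totalField_shipPr_three
    (V := ![fun _ => (0, 0, ![1, 0]),
      fun _ => (0, 0, ![0, 1]),
      surgeFieldThree,
      fun _ => (0, ![0, 0, 0, 0, 0, 0, 1], 0),
      swayFieldThree,
      fun _ => (0, ![0, 0, 0, 0, 0, 1, 0], 0),
      fun _ => (0, ![0, 0, 0, 1, 0, 0, 0], 0)])
    (fun i => ?_) (by simp) ?_ p
  · fin_cases i
    exacts [c₁.succ.succ, c₂.succ.succ, hs.succ, hv.succ, hw, hy, hz]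
  · refine Dense.mono (fun p hp => ?_) (dense_state_ne_zero (4 : Fin 7))
    simp only [Set.mem_ofPred_eq] at hp ⊢
    rw [Fintype.linearIndependent_iff]
    intro c hc
    have hx := fun i => congrFun (congrArg (fun v : Phase (Fin 7) (Fin 2) => v.2.1) hc) i
    have hu := fun i => congrFun (congrArg (fun v : Phase (Fin 7) (Fin 2) => v.2.2) hc) i
    simp [Fin.sum_univ_succ, surgeFieldThree, swayFieldThree, Fin.forall_fin_succ] at hx hu ⊢
    obtain ⟨h₀, h₁, h₆, h₅, h₃⟩ := hx
    obtain ⟨h₂, h⟩ := eq_zero_of_rotation (θ := p.2.1 2) (a := c 2) (b := 2 * c 4 * p.2.1 4)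
      (by linear_combination h₀) (by linear_combination h₁)
    have h₄ : c 4 = 0 := by simpa [hp] using h
    refine ⟨hu.1, hu.2, h₂, h₃, h₄, h₅, ?_⟩
    simpa [h₂, h₄] using h₆

end ShipControl

namespace ShipControl

open Real

/-! ### The outputs and their derivatives in the body frame

The position is `(x, y) = (p cos θ - q sin θ, p sin θ + q cos θ)`, and `s = (u₂, v₁, v₂, v₃, v₄)`. -/

/-- The coordinate of the position in the direction of the ship. -/
def surge (x y θ : ℝ) : ℝ := x * cos θ + y * sin θ

/-- The coordinate of the position across the direction of the ship. -/
def sway (x y θ : ℝ) : ℝ := y * cos θ - x * sin θ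

/-- The output `a`. -/
def jetA₀ (p q z : ℝ) (s : Fin 5 → ℝ) : ℝ :=
  2 * s 0 ^ 2 * p + (s 1 + s 0) * q + 2 * s 0 * z

/-- The output `ȧ`. -/
def jetA₁ (p q z : ℝ) (s : Fin 5 → ℝ) : ℝ :=
  (3 * s 0 * s 1 - s 0 ^ 2) * p + (2 * s 0 ^ 3 + s 2 + s 1) * q + (3 * s 1 - s 0) * z

/-- The output `ä`. -/
def jetA₂ (p q z : ℝ) (s : Fin 5 → ℝ) : ℝ :=
  (3 * s 1 ^ 2 + 2 * s 0 * s 2 - 3 * s 0 * s 1 - 2 * s 0 ^ 4) * p +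
    (9 * s 0 ^ 2 * s 1 + s 3 + s 2 - s 0 ^ 3) * q + (4 * s 2 - 3 * s 1 + 2 * s 0 ^ 3 + s 0) * z

/-- The part of the third derivative of `a` that does not contain `u₁`. -/
def driftA₃ (p q z : ℝ) (s : Fin 5 → ℝ) : ℝ :=
  (8 * s 1 * s 2 + s 0 * s 3 - 3 * s 1 ^ 2 - 4 * s 0 * s 2 - 17 * s 0 ^ 3 * s 1 + s 0 ^ 4) * p +
    (18 * s 0 * s 1 ^ 2 + 9 * s 0 ^ 2 * s 2 + s 4 + s 3 - 3 * s 0 ^ 2 * s 1 +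
      s 0 * (3 * s 1 ^ 2 + 2 * s 0 * s 2 - 3 * s 0 * s 1 - 2 * s 0 ^ 4)) * q +
    (5 * s 3 - 6 * s 2 + 15 * s 0 ^ 2 * s 1 + 4 * s 1 - 3 * s 0 ^ 3 - s 0) * z

/-- The function `ℓ` of `(u₂, v₁, v₂, v₃, v₄)`. -/
abbrev ellVec (s : Fin 5 → ℝ) : ℝ := ell (s 0) (s 1) (s 2)

/-- The third derivative of `a`. -/
def jetA₃ (p q z u : ℝ) (s : Fin 5 → ℝ) : ℝ := driftA₃ p q z s - ellVec s * u

theorem outputA_eq_jetA₀ (x y θ z : ℝ) (s : Fin 5 → ℝ) :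
    outputA x y θ z (s 0) (s 1) = jetA₀ (surge x y θ) (sway x y θ) z s := by
  simp only [outputA, jetA₀, surge, sway]
  ring

section Derivatives

variable {t p' q' z' u : ℝ} {p q z : ℝ → ℝ} {s : ℝ → Fin 5 → ℝ}

/-- The derivatives of `p`, `q`, `z` are arbitrary here. As `jetA₀` is linear in `(p, q, z)`, their
deviation from the equations of the ship enters as a separate summand. It vanishes along
trajectories, and in the converse direction it is shown to vanish. The value of `u` is free, because
`jetA₀` annihilates the direction `(1, 0, -u₂)` of `u₁`. -/
theorem hasDerivAt_jetA₀ (hp : HasDerivAt p p' t) (hq : HasDerivAt q q' t)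
    (hz : HasDerivAt z z' t)
    (hs : ∀ i : Fin 4, HasDerivAt (fun t => s t i.castSucc) (s t i.succ) t) :
    HasDerivAt (fun t => jetA₀ (p t) (q t) (z t) (s t)) (jetA₁ (p t) (q t) (z t) (s t) +
      jetA₀ (p' - (u + s t 0 * q t)) (q' - (z t - s t 0 * p t)) (z' - (-(u * s t 0) - z t))
        (s t)) t := by
  have h0 : HasDerivAt (fun t => s t 0) (s t 1) t := hs 0
  have h1 : HasDerivAt (fun t => s t 1) (s t 2) t := hs 1
  refine (((((h0.fun_pow 2).const_mul 2).mul hp).add ((h1.add h0).mul hq)).add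
    ((h0.const_mul 2).mul hz)).congr_deriv ?_
  simp only [jetA₀, jetA₁, Pi.add_apply]
  push_cast
  ring

theorem hasDerivAt_jetA₁ (hp : HasDerivAt p p' t) (hq : HasDerivAt q q' t)
    (hz : HasDerivAt z z' t)
    (hs : ∀ i : Fin 4, HasDerivAt (fun t => s t i.castSucc) (s t i.succ) t) :
    HasDerivAt (fun t => jetA₁ (p t) (q t) (z t) (s t)) (jetA₂ (p t) (q t) (z t) (s t) +
      jetA₁ (p' - (u + s t 0 * q t)) (q' - (z t - s t 0 * p t)) (z' - (-(u * s t 0) - z t))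
        (s t)) t := by
  have h0 : HasDerivAt (fun t => s t 0) (s t 1) t := hs 0
  have h1 : HasDerivAt (fun t => s t 1) (s t 2) t := hs 1
  have h2 : HasDerivAt (fun t => s t 2) (s t 3) t := hs 2
  refine ((((((h0.const_mul 3).mul h1).sub (h0.fun_pow 2)).mul hp).add
    (((((h0.fun_pow 3).const_mul 2).add h2).add h1).mul hq)).add
    (((h1.const_mul 3).sub h0).mul hz)).congr_deriv ?_
  simp only [jetA₁, jetA₂, Pi.add_apply, Pi.sub_apply, Pi.mul_apply]
  push_cast
  ring

/-- This is where `u₁` first enters: `jetA₂` takes the value `-ℓ` on the direction `(1, 0, -u₂)`. -/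
theorem hasDerivAt_jetA₂ (hp : HasDerivAt p p' t) (hq : HasDerivAt q q' t)
    (hz : HasDerivAt z z' t)
    (hs : ∀ i : Fin 4, HasDerivAt (fun t => s t i.castSucc) (s t i.succ) t) :
    HasDerivAt (fun t => jetA₂ (p t) (q t) (z t) (s t)) (jetA₃ (p t) (q t) (z t) u (s t) +
      jetA₂ (p' - (u + s t 0 * q t)) (q' - (z t - s t 0 * p t)) (z' - (-(u * s t 0) - z t))
        (s t)) t := by
  have h0 : HasDerivAt (fun t => s t 0) (s t 1) t := hs 0
  have h1 : HasDerivAt (fun t => s t 1) (s t 2) t := hs 1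
  have h2 : HasDerivAt (fun t => s t 2) (s t 3) t := hs 2
  have h3 : HasDerivAt (fun t => s t 3) (s t 4) t := hs 3
  refine ((((((((h1.fun_pow 2).const_mul 3).add ((h0.const_mul 2).mul h2)).sub
    ((h0.const_mul 3).mul h1)).sub ((h0.fun_pow 4).const_mul 2)).mul hp).add
    (((((((h0.fun_pow 2).const_mul 9).mul h1).add h3).add h2).sub (h0.fun_pow 3)).mul hq)).add
    (((((h2.const_mul 4).sub (h1.const_mul 3)).add ((h0.fun_pow 3).const_mul 2)).add h0).mul
      hz)).congr_deriv ?_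
  simp only [jetA₂, jetA₃, driftA₃, ell, Pi.add_apply, Pi.sub_apply, Pi.mul_apply]
  push_cast
  ring

theorem hasDerivAt_surge {x y θ : ℝ → ℝ} {ζ s₀ : ℝ}
    (hx : HasDerivAt x (u * cos (θ t) - ζ * sin (θ t)) t)
    (hy : HasDerivAt y (u * sin (θ t) + ζ * cos (θ t)) t) (hθ : HasDerivAt θ s₀ t) :
    HasDerivAt (fun t => surge (x t) (y t) (θ t)) (u + s₀ * sway (x t) (y t) (θ t)) t := by
  refine ((hx.mul hθ.cos).add (hy.mul hθ.sin)).congr_deriv ?_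
  simp only [sway]
  linear_combination u * sin_sq_add_cos_sq (θ t)

theorem hasDerivAt_sway {x y θ : ℝ → ℝ} {ζ s₀ : ℝ}
    (hx : HasDerivAt x (u * cos (θ t) - ζ * sin (θ t)) t)
    (hy : HasDerivAt y (u * sin (θ t) + ζ * cos (θ t)) t) (hθ : HasDerivAt θ s₀ t) :
    HasDerivAt (fun t => sway (x t) (y t) (θ t)) (ζ - s₀ * surge (x t) (y t) (θ t)) t := by
  refine ((hy.mul hθ.cos).sub (hx.mul hθ.sin)).congr_deriv ?_
  simp only [surge]
  linear_combination ζ * sin_sq_add_cos_sq (θ t)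

end Derivatives

/-! ### Recovering the states and controls -/

/-- The sway coordinate as a function of the jets of the outputs. -/
def recSway (a : Fin 4 → ℝ) (s : Fin 5 → ℝ) : ℝ :=
  (2 * s 0 * a 1 - (3 * s 1 - s 0) * a 0) / ellVec s

/-- The combination `z + u₂ p` as a function of the jets of the outputs. -/
def recSum (a : Fin 4 → ℝ) (s : Fin 5 → ℝ) : ℝ :=
  ((2 * s 0 ^ 3 + s 2 + s 1) * a 0 - (s 1 + s 0) * a 1) / ellVec s

/-- The surge coordinate as a function of the jets of the outputs. -/
def recSurge (a : Fin 4 → ℝ) (s : Fin 5 → ℝ) : ℝ :=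
  ((9 * s 0 ^ 2 * s 1 + s 3 + s 2 - s 0 ^ 3) * recSway a s +
    (4 * s 2 - 3 * s 1 + 2 * s 0 ^ 3 + s 0) * recSum a s - a 2) / ellVec s

/-- The state `z` as a function of the jets of the outputs. -/
def recZ (a : Fin 4 → ℝ) (s : Fin 5 → ℝ) : ℝ := recSum a s - s 0 * recSurge a s

/-- The control `u₁` as a function of the jets of the outputs. -/
def recU (a : Fin 4 → ℝ) (s : Fin 5 → ℝ) : ℝ :=
  (driftA₃ (recSurge a s) (recSway a s) (recZ a s) s - a 3) / ellVec s

section Inverse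

variable {p q z u : ℝ} {a : Fin 4 → ℝ} {s : Fin 5 → ℝ}

/-- Cramer's rule: `a` and `ȧ` depend on `p` and `z` only through `z + u₂ p`, and the determinant of
the system for `q` and `z + u₂ p` is `-ℓ`. -/
theorem recSway_eq (h : ellVec s ≠ 0) (h0 : a 0 = jetA₀ p q z s) (h1 : a 1 = jetA₁ p q z s) :
    recSway a s = q := by
  rw [recSway, div_eq_iff h, h0, h1]
  simp only [jetA₀, jetA₁, ell]
  ring

theorem recSum_eq (h : ellVec s ≠ 0) (h0 : a 0 = jetA₀ p q z s) (h1 : a 1 = jetA₁ p q z s) :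
    recSum a s = z + s 0 * p := by
  rw [recSum, div_eq_iff h, h0, h1]
  simp only [jetA₀, jetA₁, ell]
  ring

/-- Once `z` is eliminated in favour of `z + u₂ p`, the coefficient of `p` in `ä` is `-ℓ`. -/
theorem recSurge_eq (h : ellVec s ≠ 0) (h0 : a 0 = jetA₀ p q z s) (h1 : a 1 = jetA₁ p q z s)
    (h2 : a 2 = jetA₂ p q z s) : recSurge a s = p := by
  rw [recSurge, div_eq_iff h, recSway_eq h h0 h1, recSum_eq h h0 h1, h2]
  simp only [jetA₂, ell]
  ring

theorem recZ_eq (h : ellVec s ≠ 0) (h0 : a 0 = jetA₀ p q z s) (h1 : a 1 = jetA₁ p q z s)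
    (h2 : a 2 = jetA₂ p q z s) : recZ a s = z := by
  rw [recZ, recSum_eq h h0 h1, recSurge_eq h h0 h1 h2]
  ring

theorem recU_eq (h : ellVec s ≠ 0) (h0 : a 0 = jetA₀ p q z s) (h1 : a 1 = jetA₁ p q z s)
    (h2 : a 2 = jetA₂ p q z s) (h3 : a 3 = jetA₃ p q z u s) : recU a s = u := by
  rw [recU, div_eq_iff h, recSway_eq h h0 h1, recSurge_eq h h0 h1 h2, recZ_eq h h0 h1 h2, h3]
  simp only [jetA₃]
  ring

/-- The three outputs `a`, `ȧ`, `ä` determine the position and `z`. -/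
theorem eq_zero_of_jetA_eq_zero (h : ellVec s ≠ 0) (h0 : jetA₀ p q z s = 0)
    (h1 : jetA₁ p q z s = 0) (h2 : jetA₂ p q z s = 0) : p = 0 ∧ q = 0 ∧ z = 0 := by
  -- The recovery formulas are applied to the zero jet of `a`, where they all return zero.
  have e0 : (0 : Fin 4 → ℝ) 0 = jetA₀ p q z s := h0.symm
  have e1 : (0 : Fin 4 → ℝ) 1 = jetA₁ p q z s := h1.symm
  have e2 : (0 : Fin 4 → ℝ) 2 = jetA₂ p q z s := h2.symm
  refine ⟨?_, ?_, ?_⟩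
  · rw [← recSurge_eq h e0 e1 e2]
    simp [recSurge, recSway, recSum]
  · rw [← recSway_eq h e0 e1]
    simp [recSway]
  · rw [← recZ_eq h e0 e1 e2]
    simp [recZ, recSurge, recSway, recSum]

/-- The recovery formulas are also a right inverse, for jets that are not assumed to come from a
state. The image of the contact map and the converse half of flatness rest on this. -/
theorem jetA₀_rec (h : ellVec s ≠ 0) :
    jetA₀ (recSurge a s) (recSway a s) (recZ a s) s = a 0 := by
  have e : jetA₀ (recSurge a s) (recSway a s) (recZ a s) s =
      (s 1 + s 0) * recSway a s + 2 * s 0 * recSum a s := by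
    simp only [jetA₀, recZ]
    ring
  rw [e, recSway, recSum]
  field_simp
  simp only [ell]
  ring

theorem jetA₁_rec (h : ellVec s ≠ 0) :
    jetA₁ (recSurge a s) (recSway a s) (recZ a s) s = a 1 := by
  have e : jetA₁ (recSurge a s) (recSway a s) (recZ a s) s =
      (2 * s 0 ^ 3 + s 2 + s 1) * recSway a s + (3 * s 1 - s 0) * recSum a s := by
    simp only [jetA₁, recZ]
    ring
  rw [e, recSway, recSum]
  field_simp
  simp only [ell]
  ring

theorem jetA₂_rec (h : ellVec s ≠ 0) :
    jetA₂ (recSurge a s) (recSway a s) (recZ a s) s = a 2 := by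
  have e : jetA₂ (recSurge a s) (recSway a s) (recZ a s) s =
      -(ellVec s * recSurge a s) + ((9 * s 0 ^ 2 * s 1 + s 3 + s 2 - s 0 ^ 3) * recSway a s +
        (4 * s 2 - 3 * s 1 + 2 * s 0 ^ 3 + s 0) * recSum a s) := by
    simp only [jetA₂, recZ, ell]
    ring
  rw [e, recSurge, mul_div_cancel₀ _ h]
  ring

theorem jetA₃_rec (h : ellVec s ≠ 0) :
    jetA₃ (recSurge a s) (recSway a s) (recZ a s) (recU a s) s = a 3 := by
  rw [jetA₃, recU, mul_div_cancel₀ _ h]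
  ring

end Inverse

section Smooth

variable {E : Type*} [NormedAddCommGroup E] [NormedSpace ℝ E] {U : Set E}
  {a : E → Fin 4 → ℝ} {s : E → Fin 5 → ℝ}

theorem contDiffOn_ellVec (hs : ContDiffOn ℝ ∞ s U) :
    ContDiffOn ℝ ∞ (fun x => ellVec (s x)) U := by
  simp only [ell]
  fun_prop

theorem contDiffOn_recSway (ha : ContDiffOn ℝ ∞ a U) (hs : ContDiffOn ℝ ∞ s U)
    (h : ∀ x ∈ U, ellVec (s x) ≠ 0) : ContDiffOn ℝ ∞ (fun x => recSway (a x) (s x)) U :=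
  ContDiffOn.div (by fun_prop) (contDiffOn_ellVec hs) h

theorem contDiffOn_recSum (ha : ContDiffOn ℝ ∞ a U) (hs : ContDiffOn ℝ ∞ s U)
    (h : ∀ x ∈ U, ellVec (s x) ≠ 0) : ContDiffOn ℝ ∞ (fun x => recSum (a x) (s x)) U :=
  ContDiffOn.div (by fun_prop) (contDiffOn_ellVec hs) h

theorem contDiffOn_recSurge (ha : ContDiffOn ℝ ∞ a U) (hs : ContDiffOn ℝ ∞ s U)
    (h : ∀ x ∈ U, ellVec (s x) ≠ 0) : ContDiffOn ℝ ∞ (fun x => recSurge (a x) (s x)) U := by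
  have h1 := contDiffOn_recSway ha hs h
  have h2 := contDiffOn_recSum ha hs h
  exact ContDiffOn.div (by fun_prop) (contDiffOn_ellVec hs) h

theorem contDiffOn_recZ (ha : ContDiffOn ℝ ∞ a U) (hs : ContDiffOn ℝ ∞ s U)
    (h : ∀ x ∈ U, ellVec (s x) ≠ 0) : ContDiffOn ℝ ∞ (fun x => recZ (a x) (s x)) U := by
  have h1 := contDiffOn_recSurge ha hs h
  have h2 := contDiffOn_recSum ha hs h
  simp only [recZ]
  fun_prop

theorem contDiffOn_recU (ha : ContDiffOn ℝ ∞ a U) (hs : ContDiffOn ℝ ∞ s U)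
    (h : ∀ x ∈ U, ellVec (s x) ≠ 0) : ContDiffOn ℝ ∞ (fun x => recU (a x) (s x)) U := by
  have h1 := contDiffOn_recSurge ha hs h
  have h2 := contDiffOn_recSway ha hs h
  have h3 := contDiffOn_recZ ha hs h
  refine ContDiffOn.div ?_ (contDiffOn_ellVec hs) h
  simp only [driftA₃]
  fun_prop

end Smooth

/-- The position from its coordinates in the body frame. -/
def posX (p q θ : ℝ) : ℝ := p * cos θ - q * sin θ

/-- The position from its coordinates in the body frame. -/
def posY (p q θ : ℝ) : ℝ := p * sin θ + q * cos θ

theorem surge_pos (p q θ : ℝ) : surge (posX p q θ) (posY p q θ) θ = p := by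
  simp only [surge, posX, posY]
  linear_combination p * sin_sq_add_cos_sq θ

theorem sway_pos (p q θ : ℝ) : sway (posX p q θ) (posY p q θ) θ = q := by
  simp only [sway, posX, posY]
  linear_combination q * sin_sq_add_cos_sq θ

theorem posX_surge_sway (x y θ : ℝ) : posX (surge x y θ) (sway x y θ) θ = x := by
  simp only [surge, sway, posX]
  linear_combination x * sin_sq_add_cos_sq θ

theorem posY_surge_sway (x y θ : ℝ) : posY (surge x y θ) (sway x y θ) θ = y := by
  simp only [surge, sway, posY]
  linear_combination y * sin_sq_add_cos_sq θ

end ShipControl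

namespace ShipControl

open Real

/-! ### The four-fold prolongation -/

theorem totalField_shipPr_four : totalField (shipPr 4) = fun p : Phase (Fin 8) (Fin 2) =>
    (1, ![p.2.2 0 * cos (p.2.1 2) - p.2.1 3 * sin (p.2.1 2),
      p.2.2 0 * sin (p.2.1 2) + p.2.1 3 * cos (p.2.1 2), p.2.1 4,
      -(p.2.2 0 * p.2.1 4) - p.2.1 3, p.2.1 5, p.2.1 6, p.2.1 7, p.2.2 1], 0) := by
  funext p
  refine Prod.ext rfl (Prod.ext (funext fun i => ?_) rfl)
  fin_cases i <;> rfl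

/-- The total derivative from the derivative along a line. -/
theorem totalDeriv_eq {ι μ : Type} [Fintype ι] [Fintype μ] {S : ControlSystem ι μ}
    {f : Phase ι μ → ℝ} (hf : ContDiff ℝ ∞ f) {p : Phase ι μ} {d : ℝ}
    (hd : HasDerivAt (fun s : ℝ => f (p + s • totalField S p)) d 0) : totalDeriv S f p = d := by
  have hγ : HasDerivAt (fun s : ℝ => p + s • totalField S p) (totalField S p) 0 := by
    simpa using ((hasDerivAt_id (0 : ℝ)).smul_const (totalField S p)).const_add p
  have hp0 : p + (0 : ℝ) • totalField S p = p := by simp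
  have h1 := HasFDerivAt.comp_hasDerivAt (0 : ℝ)
    (hp0.symm ▸ (hf.differentiable (by simp) p).hasFDerivAt) hγ
  rw [hp0] at h1
  exact h1.unique hd

/-- The coordinates `(u₂, v₁, v₂, v₃, v₄)`. -/
def yawJet (p : Phase (Fin 8) (Fin 2)) : Fin 5 → ℝ :=
  ![p.2.1 4, p.2.1 5, p.2.1 6, p.2.1 7, p.2.2 1]

theorem contDiff_yawJet : ContDiff ℝ ∞ yawJet := by
  refine contDiff_pi.2 fun i => ?_
  fin_cases i <;> simp [yawJet] <;> fun_prop

/-- The surge coordinate on the phase space. -/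
def surgeAt (p : Phase (Fin 8) (Fin 2)) : ℝ := surge (p.2.1 0) (p.2.1 1) (p.2.1 2)

/-- The sway coordinate on the phase space. -/
def swayAt (p : Phase (Fin 8) (Fin 2)) : ℝ := sway (p.2.1 0) (p.2.1 1) (p.2.1 2)

theorem contDiff_surgeAt : ContDiff ℝ ∞ surgeAt := by
  unfold surgeAt surge
  fun_prop

theorem contDiff_swayAt : ContDiff ℝ ∞ swayAt := by
  unfold swayAt sway
  fun_prop

/-- The output `a` and its first three derivatives along `T`. -/
def outA (p : Phase (Fin 8) (Fin 2)) : Fin 4 → ℝ :=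
  ![jetA₀ (surgeAt p) (swayAt p) (p.2.1 3) (yawJet p),
    jetA₁ (surgeAt p) (swayAt p) (p.2.1 3) (yawJet p),
    jetA₂ (surgeAt p) (swayAt p) (p.2.1 3) (yawJet p),
    jetA₃ (surgeAt p) (swayAt p) (p.2.1 3) (p.2.2 0) (yawJet p)]

/-- The output `θ` and its first five derivatives along `T`. -/
def outTheta (p : Phase (Fin 8) (Fin 2)) : Fin 6 → ℝ :=
  ![p.2.1 2, p.2.1 4, p.2.1 5, p.2.1 6, p.2.1 7, p.2.2 1]

theorem contDiff_outA (i : Fin 4) : ContDiff ℝ ∞ fun p => outA p i := by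
  have h1 := contDiff_surgeAt
  have h2 := contDiff_swayAt
  have h3 := contDiff_yawJet
  fin_cases i <;> simp [outA, jetA₀, jetA₁, jetA₂, jetA₃, driftA₃, ell] <;> fun_prop

theorem contDiff_outTheta (i : Fin 6) : ContDiff ℝ ∞ fun p => outTheta p i := by
  fin_cases i <;> simp [outTheta] <;> fun_prop

/-- Since `u₁` and `v₄` first occur in the third derivative of `a`, the new states are functions of
`(t, x)`, as a static feedback transformation requires. -/
theorem outA_control_eq (t : ℝ) (x : Fin 8 → ℝ) (u v : Fin 2 → ℝ) (i : Fin 3) :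
    outA (t, x, u) i.castSucc = outA (t, x, v) i.castSucc := by
  fin_cases i <;> simp [outA, jetA₀, jetA₁, jetA₂, surgeAt, swayAt, yawJet]

theorem outTheta_control_eq (t : ℝ) (x : Fin 8 → ℝ) (u v : Fin 2 → ℝ) (i : Fin 5) :
    outTheta (t, x, u) i.castSucc = outTheta (t, x, v) i.castSucc := by
  fin_cases i <;> simp [outTheta]

section Curve

variable {γ : ℝ → Phase (Fin 8) (Fin 2)} {t : ℝ}

/-- Only the states need to move along `T`, and only at time `t`. The statement thus serves both for
straight lines, which give derivatives along `T`, and for lifted trajectories. -/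
theorem hasDerivAt_outA
    (h : ∀ i, HasDerivAt (fun τ => (γ τ).2.1 i) ((totalField (shipPr 4) (γ t)).2.1 i) t)
    (i : Fin 3) : HasDerivAt (fun τ => outA (γ τ) i.castSucc) (outA (γ t) i.succ) t := by
  rw [totalField_shipPr_four] at h
  have hp : HasDerivAt (fun τ => surgeAt (γ τ))
      ((γ t).2.2 0 + yawJet (γ t) 0 * swayAt (γ t)) t := hasDerivAt_surge (h 0) (h 1) (h 2)
  have hq : HasDerivAt (fun τ => swayAt (γ τ))
      ((γ t).2.1 3 - yawJet (γ t) 0 * surgeAt (γ t)) t := hasDerivAt_sway (h 0) (h 1) (h 2)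
  have hz : HasDerivAt (fun τ => (γ τ).2.1 3)
      (-((γ t).2.2 0 * yawJet (γ t) 0) - (γ t).2.1 3) t := h 3
  have hs : ∀ i : Fin 4, HasDerivAt (fun τ => yawJet (γ τ) i.castSucc) (yawJet (γ t) i.succ) t :=
    fun i => by
      fin_cases i
      exacts [h 4, h 5, h 6, h 7]
  fin_cases i
  · refine (hasDerivAt_jetA₀ (u := (γ t).2.2 0) hp hq hz hs).congr_deriv ?_
    rw [sub_self, sub_self, sub_self]
    simp [outA, jetA₀]
  · refine (hasDerivAt_jetA₁ (u := (γ t).2.2 0) hp hq hz hs).congr_deriv ?_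
    rw [sub_self, sub_self, sub_self]
    simp [outA, jetA₁]
  · refine (hasDerivAt_jetA₂ (u := (γ t).2.2 0) hp hq hz hs).congr_deriv ?_
    rw [sub_self, sub_self, sub_self]
    simp [outA, jetA₂]

theorem hasDerivAt_outTheta
    (h : ∀ i, HasDerivAt (fun τ => (γ τ).2.1 i) ((totalField (shipPr 4) (γ t)).2.1 i) t)
    (i : Fin 5) : HasDerivAt (fun τ => outTheta (γ τ) i.castSucc) (outTheta (γ t) i.succ) t := by
  rw [totalField_shipPr_four] at h
  fin_cases i
  exacts [h 2, h 4, h 5, h 6, h 7]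

end Curve

theorem hasDerivAt_line_totalField (p : Phase (Fin 8) (Fin 2)) (i : Fin 8) :
    HasDerivAt (fun s : ℝ => (p + s • totalField (shipPr 4) p).2.1 i)
      ((totalField (shipPr 4) (p + (0 : ℝ) • totalField (shipPr 4) p)).2.1 i) 0 := by
  rw [zero_smul, add_zero]
  exact hasDerivAt_line _ _

theorem totalDeriv_outA (i : Fin 3) :
    totalDeriv (shipPr 4) (fun p => outA p i.castSucc) = fun p => outA p i.succ := by
  funext p
  refine totalDeriv_eq (contDiff_outA _) ?_
  simpa using hasDerivAt_outA (hasDerivAt_line_totalField p) i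

theorem totalDeriv_outTheta (i : Fin 5) :
    totalDeriv (shipPr 4) (fun p => outTheta p i.castSucc) = fun p => outTheta p i.succ := by
  funext p
  refine totalDeriv_eq (contDiff_outTheta _) ?_
  simpa using hasDerivAt_outTheta (hasDerivAt_line_totalField p) i

/-! ### The indices of the normal form -/

/-- The dependent variable of order three. -/
def idxA : SigIndex shipSig := ⟨2, ⟨0, by decide⟩⟩

/-- The dependent variable of order five. -/
def idxTheta : SigIndex shipSig := ⟨4, ⟨0, by decide⟩⟩

/-- The states of the chain of order three. -/
def stA (i : Fin 3) : SigState shipSig := ⟨idxA, i⟩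

/-- The states of the chain of order five. -/
def stTheta (i : Fin 5) : SigState shipSig := ⟨idxTheta, i⟩

/-- The signature is nonzero only at the positions 2 and 4 of `Fin 5`, that is, at the orders three
and five, and it equals one there. -/
theorem sigIndex_cases {P : SigIndex shipSig → Prop} (hA : P idxA) (hθ : P idxTheta) :
    ∀ j, P j := by
  rintro ⟨l, i⟩
  fin_cases l
  · exact i.elim0
  · exact i.elim0
  · have : i = ⟨0, by decide⟩ := Subsingleton.elim (α := Fin 1) _ _
    exact this ▸ hA
  · exact i.elim0
  · have : i = ⟨0, by decide⟩ := Subsingleton.elim (α := Fin 1) _ _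
    exact this ▸ hθ

theorem sigState_cases {P : SigState shipSig → Prop} (hA : ∀ i, P (stA i))
    (hθ : ∀ i, P (stTheta i)) : ∀ q, P q := by
  rintro ⟨j, i⟩
  revert i
  revert j
  exact sigIndex_cases hA hθ

theorem card_sigIndex : Fintype.card (SigIndex shipSig) = 2 := by decide

theorem iterate_totalDeriv_outA (i : Fin 4) :
    (totalDeriv (shipPr 4))^[i] (shipOutputs idxA) = fun p => outA p i := by
  induction i using Fin.induction with
  | zero =>
    funext p
    exact outputA_eq_jetA₀ _ _ _ _ (yawJet p)
  | succ i ih =>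
    rw [← totalDeriv_outA i, ← ih]
    exact Function.iterate_succ_apply' _ _ _

theorem iterate_totalDeriv_outTheta (i : Fin 6) :
    (totalDeriv (shipPr 4))^[i] (shipOutputs idxTheta) = fun p => outTheta p i := by
  induction i using Fin.induction with
  | zero => rfl
  | succ i ih =>
    rw [← totalDeriv_outTheta i, ← ih]
    exact Function.iterate_succ_apply' _ _ _

/-- The contact map of the ship. -/
abbrev shipMap : Phase (Fin 8) (Fin 2) → Phase (SigState shipSig) (SigIndex shipSig) :=
  contactMap (shipPr 4) shipSig shipOutputs

theorem shipMap_stA (p : Phase (Fin 8) (Fin 2)) (i : Fin 3) :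
    (shipMap p).2.1 (stA i) = outA p i.castSucc :=
  congrFun (iterate_totalDeriv_outA i.castSucc) p

theorem shipMap_stTheta (p : Phase (Fin 8) (Fin 2)) (i : Fin 5) :
    (shipMap p).2.1 (stTheta i) = outTheta p i.castSucc :=
  congrFun (iterate_totalDeriv_outTheta i.castSucc) p

theorem shipMap_idxA (p : Phase (Fin 8) (Fin 2)) : (shipMap p).2.2 idxA = outA p 3 :=
  congrFun (iterate_totalDeriv_outA 3) p

theorem shipMap_idxTheta (p : Phase (Fin 8) (Fin 2)) : (shipMap p).2.2 idxTheta = outTheta p 5 :=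
  congrFun (iterate_totalDeriv_outTheta 5) p

theorem contDiff_congr_fun {E : Type*} [NormedAddCommGroup E] [NormedSpace ℝ E] {f g : E → ℝ}
    (hf : ContDiff ℝ ∞ f) (h : ∀ x, g x = f x) : ContDiff ℝ ∞ g :=
  funext h ▸ hf

theorem contDiff_shipMap : ContDiff ℝ ∞ shipMap := by
  refine contDiff_fst.prodMk ((contDiff_pi.2 ?_).prodMk (contDiff_pi.2 ?_))
  · refine sigState_cases (fun i => ?_) (fun i => ?_)
    · exact contDiff_congr_fun (contDiff_outA i.castSucc) fun p => shipMap_stA p i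
    · exact contDiff_congr_fun (contDiff_outTheta i.castSucc) fun p => shipMap_stTheta p i
  · refine sigIndex_cases ?_ ?_
    · exact contDiff_congr_fun (contDiff_outA 3) shipMap_idxA
    · exact contDiff_congr_fun (contDiff_outTheta 5) shipMap_idxTheta

/-- The jet of `a` in the normal form. -/
def normalA (w : Phase (SigState shipSig) (SigIndex shipSig)) : Fin 4 → ℝ :=
  ![w.2.1 (stA 0), w.2.1 (stA 1), w.2.1 (stA 2), w.2.2 idxA]

/-- The jet of the yaw rate in the normal form. -/
def normalYaw (w : Phase (SigState shipSig) (SigIndex shipSig)) : Fin 5 → ℝ :=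
  ![w.2.1 (stTheta 1), w.2.1 (stTheta 2), w.2.1 (stTheta 3), w.2.1 (stTheta 4), w.2.2 idxTheta]

theorem normalA_shipMap (p : Phase (Fin 8) (Fin 2)) : normalA (shipMap p) = outA p := by
  funext i
  fin_cases i
  exacts [shipMap_stA p 0, shipMap_stA p 1, shipMap_stA p 2, shipMap_idxA p]

theorem normalYaw_shipMap (p : Phase (Fin 8) (Fin 2)) : normalYaw (shipMap p) = yawJet p := by
  funext i
  fin_cases i
  exacts [shipMap_stTheta p 1, shipMap_stTheta p 2, shipMap_stTheta p 3, shipMap_stTheta p 4,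
    shipMap_idxTheta p]

theorem contDiff_normalA : ContDiff ℝ ∞ normalA := by
  refine contDiff_pi.2 fun i => ?_
  fin_cases i <;> simp [normalA] <;> fun_prop

theorem contDiff_normalYaw : ContDiff ℝ ∞ normalYaw := by
  refine contDiff_pi.2 fun i => ?_
  fin_cases i <;> simp [normalYaw] <;> fun_prop

/-- The inverse of the contact map of the ship. -/
def shipInv (w : Phase (SigState shipSig) (SigIndex shipSig)) : Phase (Fin 8) (Fin 2) :=
  let p := recSurge (normalA w) (normalYaw w)
  let q := recSway (normalA w) (normalYaw w)
  let θ := w.2.1 (stTheta 0)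
  (w.1, ![posX p q θ, posY p q θ, θ, recZ (normalA w) (normalYaw w), normalYaw w 0, normalYaw w 1,
    normalYaw w 2, normalYaw w 3], ![recU (normalA w) (normalYaw w), normalYaw w 4])

/-- The points of the normal form at which `ℓ ≠ 0`. -/
def normalRegular : Set (Phase (SigState shipSig) (SigIndex shipSig)) :=
  {w | ellVec (normalYaw w) ≠ 0}

theorem continuous_ellVec : Continuous ellVec := by
  unfold ellVec ell
  fun_prop

theorem isOpen_normalRegular : IsOpen normalRegular :=
  isOpen_ne_fun (continuous_ellVec.comp contDiff_normalYaw.continuous) continuous_const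

theorem isOpen_regularSet : IsOpen regularSet :=
  isOpen_ne_fun (continuous_ellVec.comp contDiff_yawJet.continuous) continuous_const

theorem contDiffOn_shipInv : ContDiffOn ℝ ∞ shipInv normalRegular := by
  have ha := contDiff_normalA.contDiffOn (s := normalRegular)
  have hs := contDiff_normalYaw.contDiffOn (s := normalRegular)
  have h1 := contDiffOn_recSurge ha hs fun _ h => h
  have h2 := contDiffOn_recSway ha hs fun _ h => h
  have h3 := contDiffOn_recZ ha hs fun _ h => h
  have h4 := contDiffOn_recU ha hs fun _ h => h
  refine contDiff_fst.contDiffOn.prodMk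
    ((contDiffOn_pi.2 fun i => ?_).prodMk (contDiffOn_pi.2 fun i => ?_))
  · fin_cases i <;> simp [posX, posY] <;> fun_prop
  · fin_cases i <;> simp <;> fun_prop

theorem shipInv_shipMap {p : Phase (Fin 8) (Fin 2)} (hp : p ∈ regularSet) :
    shipInv (shipMap p) = p := by
  have h : ellVec (yawJet p) ≠ 0 := hp
  have e1 := recSurge_eq (a := outA p) h rfl rfl rfl
  have e2 := recSway_eq (a := outA p) h rfl rfl
  have e3 := recZ_eq (a := outA p) h rfl rfl rfl
  have e4 := recU_eq (a := outA p) h rfl rfl rfl rfl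
  have eθ : (shipMap p).2.1 (stTheta 0) = p.2.1 2 := shipMap_stTheta p 0
  simp only [shipInv, normalA_shipMap, normalYaw_shipMap, e1, e2, e3, e4, eθ]
  refine Prod.ext rfl (Prod.ext (funext fun i => ?_) (funext fun i => ?_))
  · fin_cases i
    · exact posX_surge_sway _ _ _
    · exact posY_surge_sway _ _ _
    all_goals rfl
  · fin_cases i <;> rfl

theorem yawJet_shipInv (w : Phase (SigState shipSig) (SigIndex shipSig)) :
    yawJet (shipInv w) = normalYaw w := by
  funext i
  fin_cases i <;> rfl

theorem outA_shipInv {w : Phase (SigState shipSig) (SigIndex shipSig)} (hw : w ∈ normalRegular) :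
    outA (shipInv w) = normalA w := by
  have h : ellVec (normalYaw w) ≠ 0 := hw
  have hp : surgeAt (shipInv w) = recSurge (normalA w) (normalYaw w) := surge_pos _ _ _
  have hq : swayAt (shipInv w) = recSway (normalA w) (normalYaw w) := sway_pos _ _ _
  have hz : (shipInv w).2.1 3 = recZ (normalA w) (normalYaw w) := rfl
  have hu : (shipInv w).2.2 0 = recU (normalA w) (normalYaw w) := rfl
  rw [outA, hp, hq, hz, hu, yawJet_shipInv, jetA₀_rec h, jetA₁_rec h, jetA₂_rec h, jetA₃_rec h]
  funext i
  fin_cases i <;> rfl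

theorem shipMap_shipInv {w : Phase (SigState shipSig) (SigIndex shipSig)}
    (hw : w ∈ normalRegular) : shipMap (shipInv w) = w := by
  have ha := outA_shipInv hw
  have hθ : ∀ i : Fin 5, outTheta (shipInv w) i.succ = normalYaw w i := fun i => by
    fin_cases i <;> rfl
  refine Prod.ext rfl (Prod.ext (funext ?_) (funext ?_))
  · refine sigState_cases (fun i => ?_) (fun i => ?_)
    · rw [shipMap_stA, ha]
      fin_cases i <;> rfl
    · rw [shipMap_stTheta]
      fin_cases i
      exacts [rfl, hθ 0, hθ 1, hθ 2, hθ 3]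
  · refine sigIndex_cases ?_ ?_
    · rw [shipMap_idxA, ha]
      rfl
    · rw [shipMap_idxTheta]
      exact hθ 4

/-- The diffeomorphism from the regular points onto its image in the normal form. -/
def shipDiffeo : OpenPartialHomeomorph (Phase (Fin 8) (Fin 2))
    (Phase (SigState shipSig) (SigIndex shipSig)) where
  toFun := shipMap
  invFun := shipInv
  source := regularSet
  target := normalRegular
  map_source' p hp := by
    change ellVec (normalYaw (shipMap p)) ≠ 0
    rw [normalYaw_shipMap]
    exact hp
  map_target' w hw := by
    change ellVec (yawJet (shipInv w)) ≠ 0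
    rw [yawJet_shipInv]
    exact hw
  left_inv' _ hp := shipInv_shipMap hp
  right_inv' _ hw := shipMap_shipInv hw
  open_source := isOpen_regularSet
  open_target := isOpen_normalRegular
  continuousOn_toFun := contDiff_shipMap.continuous.continuousOn
  continuousOn_invFun := contDiffOn_shipInv.continuousOn

theorem isStaticFeedback_shipDiffeo :
    IsStaticFeedback (shipPr 4) (contactSystem shipSig) shipDiffeo := by
  refine IsStaticFeedback.of_totalField contDiff_shipMap.contDiffOn contDiffOn_shipInv
    (by rw [card_sigIndex]; rfl) ?_ fun p _ => ?_
  -- The new states do not depend on the controls, so `α` may be read off at control zero.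
  · refine ⟨fun t x => (shipMap (t, x, 0)).2.1, fun t x u => (shipMap (t, x, u)).2.2,
      fun t x u _ => Prod.ext rfl (Prod.ext (funext ?_) rfl)⟩
    refine sigState_cases (fun i => ?_) (fun i => ?_)
    · exact (shipMap_stA (t, x, u) i).trans
        ((outA_control_eq t x u 0 i).trans (shipMap_stA (t, x, 0) i).symm)
    · exact (shipMap_stTheta (t, x, u) i).trans
        ((outTheta_control_eq t x u 0 i).trans (shipMap_stTheta (t, x, 0) i).symm)
  · have hd := (contDiff_shipMap.differentiable (by simp) p).hasFDerivAt
    funext q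
    have h1 : (fderiv ℝ shipMap p (totalField (shipPr 4) p)).2.1 q =
        totalDeriv (shipPr 4) ((totalDeriv (shipPr 4))^[q.2] (shipOutputs q.1)) p :=
      (congrArg (fun L => L (totalField (shipPr 4) p))
        (hasFDerivAt_pi'.1 hd.snd.fst q).fderiv).symm
    refine h1.trans ?_
    rw [← Function.iterate_succ_apply' (totalDeriv (shipPr 4))]
    simp only [contactSystem, brunovsky]
    -- Inside a chain the derivative of a state along `T` is the next state; at its end the order is
    -- reached and the derivative is the new control.
    split_ifs with h
    · rfl
    · have e : (q.2 : ℕ) + 1 = sigOrder shipSig q.1 := by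
        have := q.2.2
        omega
      change (totalDeriv (shipPr 4))^[(q.2 : ℕ) + 1] (shipOutputs q.1) p = _
      rw [e]
      rfl

/-- `ℓ` is a quartic polynomial in `u₂`. -/
theorem exists_polynomial_ell (a b c : ℝ) :
    ∃ P : Polynomial ℝ, P ≠ 0 ∧ ∀ s : ℝ, ell (a + s) b c = P.eval s := by
  let P : Polynomial ℝ := (Polynomial.C a + Polynomial.X) ^ 2 +
    4 * (Polynomial.C a + Polynomial.X) ^ 4 +
    2 * (Polynomial.C a + Polynomial.X) * Polynomial.C c - 3 * Polynomial.C b ^ 2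
  have hP : ∀ s : ℝ, ell (a + s) b c = P.eval s := fun s => by simp [P, ell]
  refine ⟨P, fun h => ?_, hP⟩
  have h0 : ∀ s : ℝ, ell (a + s) b c = 0 := fun s => by rw [hP, h, Polynomial.eval_zero]
  -- At the arguments `0`, `1` and `-1` of `ell` the vanishing reads `3b² = 0`, `5 + 2c = 3b²` and
  -- `5 - 2c = 3b²`, which is contradictory.
  have h1 := h0 (-a)
  have h2 := h0 (1 - a)
  have h3 := h0 (-1 - a)
  simp only [ell] at h1 h2 h3
  ring_nf at h1 h2 h3
  linarith

theorem dense_regularSet : Dense regularSet := by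
  refine dense_ne_zero_of_polynomial (f := fun p : Phase (Fin 8) (Fin 2) =>
    ell (p.2.1 4) (p.2.1 5) (p.2.1 6)) fun p => ?_
  obtain ⟨P, hP, h⟩ := exists_polynomial_ell (p.2.1 4) (p.2.1 5) (p.2.1 6)
  refine ⟨(0, Pi.single 4 1, 0), P, hP, fun s => ?_⟩
  rw [← h]
  simp

end ShipControl

/-! ### Jets of curves and flatness of the ship -/

namespace ShipControl

open Real

section Jets

variable {I : Set ℝ} {t : ℝ}

theorem contDiffOn_iteratedDeriv {E : Type*} [NormedAddCommGroup E] [NormedSpace ℝ E] {y : ℝ → E}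
    (hI : IsOpen I) (hy : ContDiffOn ℝ ∞ y I) (n : ℕ) : ContDiffOn ℝ ∞ (iteratedDeriv n y) I := by
  induction n with
  | zero => simpa using hy
  | succ n ih =>
    rw [iteratedDeriv_succ]
    exact ih.deriv_of_isOpen hI (by simp)

variable {μ : Type} [Fintype μ] {y : ℝ → μ → ℝ}

theorem hasDerivAt_iteratedDeriv_apply (hI : IsOpen I) (hy : ContDiffOn ℝ ∞ y I) (n : ℕ) (j : μ)
    (ht : t ∈ I) :
    HasDerivAt (fun τ => iteratedDeriv n y τ j) (iteratedDeriv (n + 1) y t j) t := by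
  have h := (((contDiffOn_iteratedDeriv hI hy n).contDiffAt (hI.mem_nhds ht)).differentiableAt
    (by simp)).hasDerivAt
  rw [iteratedDeriv_succ]
  exact hasDerivAt_pi.1 h j

/-- A sequence of functions, each the derivative of the preceding one, gives the iterated
derivatives of the first. -/
theorem iteratedDeriv_apply_eq (hI : IsOpen I) (hy : ContDiffOn ℝ ∞ y I) {j : μ} {N : ℕ}
    {g : Fin (N + 1) → ℝ → ℝ} (h0 : ∀ τ ∈ I, y τ j = g 0 τ)
    (hg : ∀ i : Fin N, ∀ τ ∈ I, HasDerivAt (g i.castSucc) (g i.succ τ) τ) (i : Fin (N + 1)) :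
    ∀ τ ∈ I, iteratedDeriv i y τ j = g i τ := by
  induction i using Fin.induction with
  | zero => simpa using h0
  | succ i ih =>
    intro τ hτ
    refine (hasDerivAt_iteratedDeriv_apply hI hy i j hτ).unique ?_
    exact (hg i τ hτ).congr_of_eventuallyEq (Filter.eventually_of_mem (hI.mem_nhds hτ) ih)

theorem contDiffOn_jet (hI : IsOpen I) (hy : ContDiffOn ℝ ∞ y I) (r : ℕ) :
    ContDiffOn ℝ ∞ (jet r y) I :=
  contDiffOn_pi.2 fun i => contDiffOn_iteratedDeriv hI hy i

end Jets

/-! ### The flat output -/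

/-- The jet of `a` in the space of jets of the flat output. -/
def flatA (w : ℝ × (Fin 6 → Fin 2 → ℝ)) : Fin 4 → ℝ :=
  ![w.2 0 0, w.2 1 0, w.2 2 0, w.2 3 0]

/-- The jet of the yaw rate in the space of jets of the flat output. -/
def flatYaw (w : ℝ × (Fin 6 → Fin 2 → ℝ)) : Fin 5 → ℝ := fun i => w.2 i.succ 1

/-- The jets of the flat output at which `ℓ ≠ 0`. -/
def flatRegular : Set (ℝ × (Fin 6 → Fin 2 → ℝ)) := {w | ellVec (flatYaw w) ≠ 0}

/-- The states and the controls as functions of the jets of the flat output. -/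
def flatInv (w : ℝ × (Fin 6 → Fin 2 → ℝ)) : (Fin 4 → ℝ) × (Fin 2 → ℝ) :=
  let p := recSurge (flatA w) (flatYaw w)
  let q := recSway (flatA w) (flatYaw w)
  (![posX p q (w.2 0 1), posY p q (w.2 0 1), w.2 0 1, recZ (flatA w) (flatYaw w)],
    ![recU (flatA w) (flatYaw w), w.2 1 1])

theorem contDiff_flatA : ContDiff ℝ ∞ flatA := by
  refine contDiff_pi.2 fun i => ?_
  fin_cases i <;> simp [flatA] <;> fun_prop

theorem contDiff_flatYaw : ContDiff ℝ ∞ flatYaw := by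
  unfold flatYaw
  fun_prop

theorem isOpen_flatRegular : IsOpen flatRegular :=
  isOpen_ne_fun (continuous_ellVec.comp contDiff_flatYaw.continuous) continuous_const

theorem contDiffOn_flatInv : ContDiffOn ℝ ∞ flatInv flatRegular := by
  have ha := contDiff_flatA.contDiffOn (s := flatRegular)
  have hs := contDiff_flatYaw.contDiffOn (s := flatRegular)
  have h1 := contDiffOn_recSurge ha hs fun _ h => h
  have h2 := contDiffOn_recSway ha hs fun _ h => h
  have h3 := contDiffOn_recZ ha hs fun _ h => h
  have h4 := contDiffOn_recU ha hs fun _ h => h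
  refine (contDiffOn_pi.2 fun i => ?_).prodMk (contDiffOn_pi.2 fun i => ?_)
  · fin_cases i <;> simp [posX, posY] <;> fun_prop
  · fin_cases i <;> simp <;> fun_prop

theorem isOpen_regularJets : IsOpen regularJets := by
  refine isOpen_ne_fun ?_ continuous_const
  unfold ell
  fun_prop

theorem dense_regularJets : Dense regularJets := by
  refine dense_ne_zero_of_polynomial (f := fun p : ControlJet (Fin 4) (Fin 2) 2 =>
    ell (p.2.2 0 1) (p.2.2 1 1) (p.2.2 2 1)) fun p => ?_
  obtain ⟨P, hP, h⟩ := exists_polynomial_ell (p.2.2 0 1) (p.2.2 1 1) (p.2.2 2 1)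
  refine ⟨(0, 0, Pi.single 0 (Pi.single 1 1)), P, hP, fun s => ?_⟩
  rw [← h]
  simp

theorem contDiff_shipFlatOutput : ContDiff ℝ ∞ shipFlatOutput := by
  refine contDiff_pi.2 fun i => ?_
  fin_cases i <;> simp [shipFlatOutput, outputA] <;> fun_prop

/-! ### From trajectories to the jets of `(a, θ)` -/

section Forward

variable {I : Set ℝ} {x : ℝ → Fin 4 → ℝ} {u : ℝ → Fin 2 → ℝ}

/-- The lift of a trajectory of the ship to the four-fold prolongation. -/
def liftCurve (x : ℝ → Fin 4 → ℝ) (u : ℝ → Fin 2 → ℝ) (t : ℝ) : Phase (Fin 8) (Fin 2) :=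
  (t, ![x t 0, x t 1, x t 2, x t 3, iteratedDeriv 0 u t 1, iteratedDeriv 1 u t 1,
    iteratedDeriv 2 u t 1, iteratedDeriv 3 u t 1], ![u t 0, iteratedDeriv 4 u t 1])

theorem hasDerivAt_liftCurve (hI : IsOpen I) (h : IsTrajectory ship I x u) {t : ℝ} (ht : t ∈ I)
    (i : Fin 8) : HasDerivAt (fun τ => (liftCurve x u τ).2.1 i)
      ((totalField (shipPr 4) (liftCurve x u t)).2.1 i) t := by
  have hx := hasDerivAt_pi.1 (h.ode t ht)
  have hu := fun n => hasDerivAt_iteratedDeriv_apply hI h.smooth_control n 1 ht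
  have e : iteratedDeriv 0 u t 1 = u t 1 := by simp
  rw [totalField_shipPr_four]
  fin_cases i
  · exact hx 0
  · exact hx 1
  · exact (hx 2).congr_deriv e.symm
  · refine (hx 3).congr_deriv ?_
    simp [ship, liftCurve]
  · exact hu 0
  · exact hu 1
  · exact hu 2
  · exact hu 3

theorem flatOutput_liftCurve (t : ℝ) :
    shipFlatOutput (t, x t, jet 2 u t) =
      ![outA (liftCurve x u t) 0, outTheta (liftCurve x u t) 0] := by
  funext i
  fin_cases i
  · exact outputA_eq_jetA₀ _ _ _ _ (yawJet (liftCurve x u t))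
  · rfl

/-- Along the lifted curve each component of `outA` and `outTheta` is the derivative of the
preceding one, so the iterated time derivatives of the outputs are these components. -/
theorem jet_flatOutput (hI : IsOpen I) (h : IsTrajectory ship I x u) {t : ℝ} (ht : t ∈ I) :
    flatA (t, jet 5 (fun τ => shipFlatOutput (τ, x τ, jet 2 u τ)) t) = outA (liftCurve x u t) ∧
    ∀ i : Fin 6, jet 5 (fun τ => shipFlatOutput (τ, x τ, jet 2 u τ)) t i 1 =
      outTheta (liftCurve x u t) i := by
  set y := fun τ => shipFlatOutput (τ, x τ, jet 2 u τ) with hy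
  have hsm : ContDiffOn ℝ ∞ y I := contDiff_shipFlatOutput.comp_contDiffOn
    (contDiffOn_id.prodMk (h.smooth_state.prodMk (contDiffOn_jet hI h.smooth_control 2)))
  have hA := iteratedDeriv_apply_eq hI hsm (j := 0) (g := fun i τ => outA (liftCurve x u τ) i)
    (fun τ _ => congrFun (flatOutput_liftCurve τ) 0)
    (fun i τ hτ => hasDerivAt_outA (hasDerivAt_liftCurve hI h hτ) i)
  have hT := iteratedDeriv_apply_eq hI hsm (j := 1) (g := fun i τ => outTheta (liftCurve x u τ) i)
    (fun τ _ => congrFun (flatOutput_liftCurve τ) 1)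
    (fun i τ hτ => hasDerivAt_outTheta (hasDerivAt_liftCurve hI h hτ) i)
  refine ⟨funext fun i => ?_, fun i => hT i t ht⟩
  fin_cases i
  exacts [hA 0 t ht, hA 1 t ht, hA 2 t ht, hA 3 t ht]

theorem flatInv_jet (hI : IsOpen I) (h : IsTrajectory ship I x u) {t : ℝ} (ht : t ∈ I)
    (hr : (t, x t, jet 2 u t) ∈ regularJets) :
    (t, jet 5 (fun τ => shipFlatOutput (τ, x τ, jet 2 u τ)) t) ∈ flatRegular ∧
    flatInv (t, jet 5 (fun τ => shipFlatOutput (τ, x τ, jet 2 u τ)) t) = (x t, u t) := by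
  obtain ⟨hA, hT⟩ := jet_flatOutput hI h ht
  set w := (t, jet 5 (fun τ => shipFlatOutput (τ, x τ, jet 2 u τ)) t)
  set p := liftCurve x u t with hp
  have hY : flatYaw w = yawJet p := by
    funext i
    refine (hT i.succ).trans ?_
    fin_cases i <;> rfl
  have hr' : ellVec (yawJet p) ≠ 0 := hr
  have e1 := recSurge_eq (a := outA p) hr' rfl rfl rfl
  have e2 := recSway_eq (a := outA p) hr' rfl rfl
  have e3 := recZ_eq (a := outA p) hr' rfl rfl rfl
  have e4 := recU_eq (a := outA p) hr' rfl rfl rfl rfl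
  have e5 : w.2 0 1 = x t 2 := hT 0
  have e6 : w.2 1 1 = u t 1 := (hT 1).trans (by simp [outTheta, hp, liftCurve])
  refine ⟨by change ellVec (flatYaw w) ≠ 0; rwa [hY], ?_⟩
  simp only [flatInv, hA, hY, e1, e2, e3, e4, e5, e6]
  refine Prod.ext (funext fun i => ?_) (funext fun i => ?_)
  · fin_cases i
    · exact posX_surge_sway _ _ _
    · exact posY_surge_sway _ _ _
    all_goals rfl
  · fin_cases i <;> rfl

end Forward

/-! ### From curves `(a, θ)` to trajectories -/

section Backward

variable {I : Set ℝ} {y : ℝ → Fin 2 → ℝ}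

theorem hasDerivAt_posX {t u z s₀ : ℝ} {p q θ : ℝ → ℝ} (hp : HasDerivAt p (u + s₀ * q t) t)
    (hq : HasDerivAt q (z - s₀ * p t) t) (hθ : HasDerivAt θ s₀ t) :
    HasDerivAt (fun t => posX (p t) (q t) (θ t)) (u * cos (θ t) - z * sin (θ t)) t := by
  refine ((hp.mul hθ.cos).sub (hq.mul hθ.sin)).congr_deriv ?_
  ring

theorem hasDerivAt_posY {t u z s₀ : ℝ} {p q θ : ℝ → ℝ} (hp : HasDerivAt p (u + s₀ * q t) t)
    (hq : HasDerivAt q (z - s₀ * p t) t) (hθ : HasDerivAt θ s₀ t) :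
    HasDerivAt (fun t => posY (p t) (q t) (θ t)) (u * sin (θ t) + z * cos (θ t)) t := by
  refine ((hp.mul hθ.sin).add (hq.mul hθ.cos)).congr_deriv ?_
  ring

/-- The recovered body coordinates satisfy the equations of the ship. -/
theorem hasDerivAt_rec (hI : IsOpen I) {a : ℝ → Fin 4 → ℝ} {s : ℝ → Fin 5 → ℝ}
    (hsa : ContDiffOn ℝ ∞ a I) (hss : ContDiffOn ℝ ∞ s I) (hr : ∀ t ∈ I, ellVec (s t) ≠ 0)
    {t : ℝ} (ht : t ∈ I)
    (ha : ∀ i : Fin 3, HasDerivAt (fun t => a t i.castSucc) (a t i.succ) t)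
    (hs : ∀ i : Fin 4, HasDerivAt (fun t => s t i.castSucc) (s t i.succ) t) :
    HasDerivAt (fun t => recSurge (a t) (s t))
      (recU (a t) (s t) + s t 0 * recSway (a t) (s t)) t ∧
    HasDerivAt (fun t => recSway (a t) (s t))
      (recZ (a t) (s t) - s t 0 * recSurge (a t) (s t)) t ∧
    HasDerivAt (fun t => recZ (a t) (s t))
      (-(recU (a t) (s t) * s t 0) - recZ (a t) (s t)) t := by
  have hd : ∀ f : ℝ → ℝ, ContDiffOn ℝ ∞ f I → HasDerivAt f (deriv f t) t := fun f hf =>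
    ((hf.contDiffAt (hI.mem_nhds ht)).differentiableAt (by simp)).hasDerivAt
  have hp := hd _ (contDiffOn_recSurge hsa hss hr)
  have hq := hd _ (contDiffOn_recSway hsa hss hr)
  have hz := hd _ (contDiffOn_recZ hsa hss hr)
  have hev : ∀ f g : ℝ → ℝ, (∀ t ∈ I, f t = g t) → f =ᶠ[𝓝 t] g := fun f g h =>
    Filter.eventually_of_mem (hI.mem_nhds ht) h
  -- Each identity `jetA_i = a_i` for the recovered quantities is differentiated in two ways. The
  -- derivative of `a_i` is `a_{i+1}`, which is `jetA_{i+1}` of the same quantities, so `jetA_i` of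
  -- the deviations is zero for `i = 0, 1, 2`.
  have e0 := (hasDerivAt_jetA₀ (u := recU (a t) (s t)) hp hq hz hs).unique
    ((ha 0).congr_of_eventuallyEq (hev _ _ fun t ht => jetA₀_rec (hr t ht)))
  have e1 := (hasDerivAt_jetA₁ (u := recU (a t) (s t)) hp hq hz hs).unique
    ((ha 1).congr_of_eventuallyEq (hev _ _ fun t ht => jetA₁_rec (hr t ht)))
  have e2 := (hasDerivAt_jetA₂ (u := recU (a t) (s t)) hp hq hz hs).unique
    ((ha 2).congr_of_eventuallyEq (hev _ _ fun t ht => jetA₂_rec (hr t ht)))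
  rw [jetA₁_rec (hr t ht)] at e0
  rw [jetA₂_rec (hr t ht)] at e1
  rw [jetA₃_rec (hr t ht)] at e2
  obtain ⟨h1, h2, h3⟩ := eq_zero_of_jetA_eq_zero (hr t ht) (add_eq_left.1 e0)
    (add_eq_left.1 e1) (add_eq_left.1 e2)
  exact ⟨hp.congr_deriv (sub_eq_zero.1 h1), hq.congr_deriv (sub_eq_zero.1 h2),
    hz.congr_deriv (sub_eq_zero.1 h3)⟩

theorem flatInv_isTrajectory (hI : IsOpen I) (hy : ContDiffOn ℝ ∞ y I)
    (hr : ∀ t ∈ I, (t, jet 5 y t) ∈ flatRegular) :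
    IsTrajectory ship I (fun t => (flatInv (t, jet 5 y t)).1)
      (fun t => (flatInv (t, jet 5 y t)).2) := by
  have hj : ContDiffOn ℝ ∞ (fun t => (t, jet 5 y t)) I :=
    contDiffOn_id.prodMk (contDiffOn_jet hI hy 5)
  have hF := contDiffOn_flatInv.comp hj hr
  refine ⟨hF.fst, hF.snd, fun t ht => hasDerivAt_pi.2 fun i => ?_⟩
  have hD := fun n j => hasDerivAt_iteratedDeriv_apply hI hy n j ht
  obtain ⟨hp, hq, hz⟩ := hasDerivAt_rec hI (contDiff_flatA.comp_contDiffOn hj)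
    (contDiff_flatYaw.comp_contDiffOn hj) hr ht
    (fun i => by
      fin_cases i
      exacts [hD 0 0, hD 1 0, hD 2 0])
    (fun i => hD _ 1)
  have hθ : HasDerivAt (fun τ => iteratedDeriv 0 y τ 1) (flatYaw (t, jet 5 y t) 0) t := hD 0 1
  fin_cases i
  · exact hasDerivAt_posX hp hq hθ
  · exact hasDerivAt_posY hp hq hθ
  · exact hθ
  · exact hz

theorem flatOutput_flatInv (hI : IsOpen I) (hy : ContDiffOn ℝ ∞ y I)
    (hr : ∀ t ∈ I, (t, jet 5 y t) ∈ flatRegular) {t : ℝ} (ht : t ∈ I) :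
    (t, (flatInv (t, jet 5 y t)).1, jet 2 (fun τ => (flatInv (τ, jet 5 y τ)).2) t) ∈
      regularJets ∧
    shipFlatOutput (t, (flatInv (t, jet 5 y t)).1,
      jet 2 (fun τ => (flatInv (τ, jet 5 y τ)).2) t) = y t := by
  have hu := (flatInv_isTrajectory hI hy hr).smooth_control
  -- The recovered `u₂` is `θ̇`, so its jets are those of `θ` shifted by one order.
  have hs : ∀ i : Fin 3, jet 2 (fun τ => (flatInv (τ, jet 5 y τ)).2) t i 1 =
      flatYaw (t, jet 5 y t) (i.castLE (by omega)) := fun i =>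
    iteratedDeriv_apply_eq hI hu (j := 1) (N := 2)
      (g := fun i τ => iteratedDeriv (i + 1) y τ 1) (fun _ _ => rfl)
      (fun i τ hτ => hasDerivAt_iteratedDeriv_apply hI hy (i + 1) 1 hτ) i t ht
  have h0 := hs 0
  have h1 := hs 1
  have h2 := hs 2
  have hrt : ellVec (flatYaw (t, jet 5 y t)) ≠ 0 := hr t ht
  refine ⟨?_, ?_⟩
  · change ell _ _ _ ≠ 0
    simp only [h0, h1, h2]
    exact hrt
  · funext i
    fin_cases i
    · simp only [shipFlatOutput, h0, h1]
      refine (outputA_eq_jetA₀ _ _ _ _ (flatYaw (t, jet 5 y t))).trans ?_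
      refine Eq.trans ?_ ((jetA₀_rec (a := flatA (t, jet 5 y t)) hrt).trans ?_)
      · exact congrArg₂ (fun p q => jetA₀ p q _ _) (surge_pos _ _ _) (sway_pos _ _ _)
      · simp [flatA, jet]
    · simp [shipFlatOutput, flatInv, jet]

end Backward

theorem isFlatOutputOn_shipFlatOutput :
    IsFlatOutputOn ship 2 regularJets shipFlatOutput :=
  ⟨isOpen_regularJets, contDiff_shipFlatOutput.contDiffOn, 5, flatRegular, flatInv,
    isOpen_flatRegular, contDiffOn_flatInv,
    fun _ _ _ _ h hr _ ht => flatInv_jet isOpen_Ioo h ht (hr _ ht),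
    fun _ _ _ hy hr => ⟨flatInv_isTrajectory isOpen_Ioo hy hr,
      fun _ ht => flatOutput_flatInv isOpen_Ioo hy hr ht⟩⟩

theorem not_linearizable_shipPr (k : ℕ) (hk : k < 4) (p : Phase (Fin (4 + k)) (Fin 2)) :
    ¬ StaticFeedbackLinearizableAt (shipPr k) p := by
  interval_cases k
  · exact not_linearizable_shipPr_zero p
  · exact not_linearizable_shipPr_one p
  · exact not_linearizable_shipPr_two p
  · exact not_linearizable_shipPr_three p

end ShipControl

end

theorem mainTheorem7 :
    -- four prolongations of `u₂` lead to `C⟨0,0,1,0,1⟩`, with outputs `a` and `θ`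
    (IsOpen ShipControl.regularSet ∧ Dense ShipControl.regularSet ∧
      ∃ Φ : OpenPartialHomeomorph (ShipControl.Phase (Fin 8) (Fin 2))
          (ShipControl.Phase (ShipControl.SigState ShipControl.shipSig)
            (ShipControl.SigIndex ShipControl.shipSig)),
        Φ.source = ShipControl.regularSet ∧
        (∀ p ∈ ShipControl.regularSet,
          Φ p = ShipControl.contactMap (ShipControl.shipPr 4) ShipControl.shipSig
            ShipControl.shipOutputs p) ∧
        ShipControl.IsStaticFeedback (ShipControl.shipPr 4)
          (ShipControl.contactSystem ShipControl.shipSig) Φ) ∧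
    -- fewer than four prolongations of `u₂` do not suffice, near any point
    (∀ k < 4, ∀ p : ShipControl.Phase (Fin (4 + k)) (Fin 2),
      ¬ ShipControl.StaticFeedbackLinearizableAt (ShipControl.shipPr k) p) ∧
    -- the ship is flat, with flat output `(a, θ)`
    (IsOpen ShipControl.regularJets ∧ Dense ShipControl.regularJets ∧
      ShipControl.IsFlatOutputOn ShipControl.ship 2 ShipControl.regularJets
        ShipControl.shipFlatOutput) ∧
    ShipControl.IsFlat ShipControl.ship := by
  open ShipControl in
  exact ⟨⟨isOpen_regularSet, dense_regularSet, shipDiffeo, rfl, fun _ _ => rfl,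
    isStaticFeedback_shipDiffeo⟩, not_linearizable_shipPr,
    ⟨isOpen_regularJets, dense_regularJets, isFlatOutputOn_shipFlatOutput⟩,
    2, regularJets, isOpen_regularJets, dense_regularJets,
    fun _ hp => ⟨regularJets, shipFlatOutput, hp, isFlatOutputOn_shipFlatOutput⟩⟩
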